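/- Let $l\ge 1$ be an integer, $m\in\{l-1,l,l+1\}$ and $\lambda\in\mathbb C$ with $\operatorname{Re}\lambda\ge 0$. Put $$\tilde V_{1,0}=\frac{6-2r^2}{r^2(1+r^2)},\qquad \tilde V_{1,1}=\frac{6-2r^4}{r^2(1+r^2)},\qquad \tilde V_{2,1}=\frac{12}{r^2(1+r^2)},$$ and, for all other $(l,m)$, $$\tilde V_{l,m}=\frac{(4+2m(m+1)-l(l+1))\,r^4+(2m(m+1)-12)\,r^2+l(l+1)}{r^2(1+r^2)^2}.$$ Let $p_{l,m}$ and $q_{l,m}=\dfrac{N_{l,m}(z)}{4z(z-1)(z-2)}$ be given by $$p_{1,0}=\tfrac{7}{2z}+\tfrac{\lambda}{z-1}+\tfrac{1}{2(z-2)},\qquad N_{1,0}=z(\lambda^2+6\lambda+8)-\lambda^2-12\lambda-12,$$ $$p_{1,1}=\tfrac{7}{2z}+\tfrac{\lambda}{z-1}-\tfrac{1}{2(z-2)},\qquad N_{1,1}=z(\lambda^2+4\lambda+3)-\lambda^2-12\lambda-7,$$ $$p_{2,1}=\tfrac{9}{2z}+\tfrac{\lambda}{z-1}+\tfrac{1}{2(z-2)},\qquad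 N_{2,1}=z(\lambda^2+8\lambda+15)-\lambda^2-16\lambda-27,$$ and, for all other $(l,m)$, $p_{l,m}=\tfrac{2l+3}{2z}+\tfrac{\lambda}{z-1}+\tfrac{1}{2(z-2)}$ and $$N_{l,m}=z\big((\lambda-2)(\lambda+4)+l^2+2\lambda l+2l\big)-l^2-4\lambda l-2l-2m^2-2m-\lambda^2-4\lambda+12 .$$ Then the following hold. (1) (Heun form.) Let $\Omega\subseteq\mathbb C\setminus\{0,1,2\}$ be open and connected with $(0,1)\subset\Omega$, and let $\psi$ be a complex-valued function on $\Omega\cup\{0,1\}$ that is holomorphic on $\Omega$, satisfies $$\psi''+p_{l,m}\,\psi'+q_{l,m}\,\psi=0\quad\text{on }\Omega,$$ and is smooth at $z=0$ and $z=1$ in the sense that its restriction to the real interval $[0,1]$ is $C^\infty$ up to the endpoints. Then $\psi=0$. (2) (Radial form.) If $\varphi\in C^\infty([0,1];\mathbb C)$ satisfies $$(1-r^2)\,\varphi''+\Big(\frac 2r-2(\lambda+1)r\Big)\varphi'-(\lambda^2+\lambda+\tilde V_{l,m})\,\varphi=0\quad\text{for }0<r<1,$$ then $\varphi=0$ on $[0,1]$.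 -/

import Mathlib

open Set
open scoped ContDiff

/-- The potential `V_{l,m}(r)` of the radial mode equation. -/
noncomputable def modePotential (l m : ℕ) (r : ℝ) : ℝ :=
  ((4 + 2 * m * (m + 1) - l * (l + 1)) * r ^ 4 + (2 * m * (m + 1) - 12) * r ^ 2 + l * (l + 1)) /
    (r ^ 2 * (1 + r ^ 2) ^ 2)

/-- The potential `Ṽ_{l,m}(r)` of the radial mode equation after the supersymmetric transform,
which changes the potential exactly for `(l,m)` among `(0,1)`, `(1,0)`, `(1,1)`, `(2,1)`. -/
noncomputable def susyPotential (l m : ℕ) (r : ℝ) : ℝ :=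
  if (l, m) = (0, 1) then 6 / r ^ 2
  else if (l, m) = (1, 0) then (6 - 2 * r ^ 2) / (r ^ 2 * (1 + r ^ 2))
  else if (l, m) = (1, 1) then (6 - 2 * r ^ 4) / (r ^ 2 * (1 + r ^ 2))
  else if (l, m) = (2, 1) then 12 / (r ^ 2 * (1 + r ^ 2))
  else modePotential l m r

/-- `φ` solves the transformed radial mode equation with growth rate `μ` on `0 < r < 1`:
`(1 - r²) φ'' + (2/r - 2(μ+1) r) φ' - (μ² + μ + Ṽ_{l,m}) φ = 0`. -/
def SolvesRadialModeEq (l m : ℕ) (μ : ℂ) (φ : ℝ → ℂ) : Prop :=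
  ∀ r ∈ Ioo (0 : ℝ) 1,
    (1 - (r : ℂ) ^ 2) * deriv (deriv φ) r
      + (2 / (r : ℂ) - 2 * (μ + 1) * r) * deriv φ r
      - (μ ^ 2 + μ + (susyPotential l m r : ℂ)) * φ r = 0

/-- The first-order coefficient `p_{l,m}(z)` of the Heun form of the mode equation (`l > 0`). -/
noncomputable def heunP (l m : ℕ) (μ z : ℂ) : ℂ :=
  if (l, m) = (1, 0) then 7 / (2 * z) + μ / (z - 1) + 1 / (2 * (z - 2))
  else if (l, m) = (1, 1) then 7 / (2 * z) + μ / (z - 1) - 1 / (2 * (z - 2))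
  else if (l, m) = (2, 1) then 9 / (2 * z) + μ / (z - 1) + 1 / (2 * (z - 2))
  else (2 * l + 3) / (2 * z) + μ / (z - 1) + 1 / (2 * (z - 2))

/-- The zeroth-order coefficient `q_{l,m}(z)` of the Heun form of the mode equation (`l > 0`). -/
noncomputable def heunQ (l m : ℕ) (μ z : ℂ) : ℂ :=
  (if (l, m) = (1, 0) then z * (μ ^ 2 + 6 * μ + 8) - μ ^ 2 - 12 * μ - 12
    else if (l, m) = (1, 1) then z * (μ ^ 2 + 4 * μ + 3) - μ ^ 2 - 12 * μ - 7
    else if (l, m) = (2, 1) then z * (μ ^ 2 + 8 * μ + 15) - μ ^ 2 - 16 * μ - 27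
    else z * ((μ - 2) * (μ + 4) + l ^ 2 + 2 * μ * l + 2 * l)
      - l ^ 2 - 4 * μ * l - 2 * l - 2 * m ^ 2 - 2 * m - μ ^ 2 - 4 * μ + 12) /
    (4 * (z - 2) * (z - 1) * z)

/-- `ψ` is a holomorphic solution on `Ω` of the Heun form `ψ'' + p_{l,m} ψ' + q_{l,m} ψ = 0` of the
transformed mode equation. -/
def SolvesHeunModeEq (l m : ℕ) (μ : ℂ) (Ω : Set ℂ) (ψ : ℂ → ℂ) : Prop :=
  DifferentiableOn ℂ ψ Ω ∧
    ∀ z ∈ Ω, deriv (deriv ψ) z + heunP l m μ z * deriv ψ z + heunQ l m μ z * ψ z = 0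

/-!
Uniqueness of smooth solutions of the mode equations is proved by a moment method on the real
interval, without any power series expansion or analytic continuation of the solution.

In the coordinate `z = 2 r ^ 2 / (1 + r ^ 2)` (`heunCoord`) and after splitting off `modeFactor`, the
radial operator becomes a Heun operator with singular points `0`, `1`, `2`, `∞`, and this operator is
tridiagonal on the monomials `z ^ n` (`radialOp_conj`, `heunOp_pow`). All pairs `(l, m)` are covered by
one family with parameters `L`, `b`, `s`, `κ`.

The radial operator is formally self-adjoint with respect to the weight `r ^ 2 (1 - r ^ 2) ^ (μ - 1)`
(`radialWronskian_divergence`). Testing a smooth solution `φ` against the functions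
`modeFactor * z ^ n` therefore shows that its moments `M n` satisfy the transposed recurrence
`lowerCoeff n * M (n - 1) + diagCoeff n * M n + upperCoeff n * M (n + 1) = 0`. For `re μ = 0` the weight
is not integrable, and the moments are taken as Hadamard finite parts (`finitePart`), which satisfy
the same integration by parts formula as long as `μ ≠ 0`. For `μ = 0` the equation forces `φ 1 = 0`,
and test functions with an additional factor `1 - r ^ 2` lead to the recurrence with `μ = 2` instead.

The solutions of the recurrence behave like `1 ^ n` or `2 ^ n`, up to powers of `n`. Smoothness of `φ`
at `r = 1` bounds the moments linearly, so that they belong to the first kind. On the other hand, in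
the half-plane `0 ≤ re μ` the diagonal coefficient strictly dominates the sum of the other two
(`dominant_of_pos`, `dominant_of_zero`), so that the norms of a nonzero solution increase, and do so
exponentially (`eq_zero_of_dominant_recurrence`). Only for `(l, m) = (1, 2)` the first two rows have to
be combined (`recurrenceRigid_one_two`). Hence all moments vanish, and `φ = 0` by the Weierstrass
approximation theorem (`eqOn_zero_of_moments`).

The Heun form is reduced to the radial form (`heun_unique`).
-/

/-! ### The three-term recurrence of the Heun operator -/

/-- The coefficient of `z ^ (n - 1)` in the Heun operator `heunOp` applied to `z ^ n`; see
`heunOp_pow`. -/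
def lowerCoeff (L n : ℕ) : ℝ := 4 * n * (2 * n + 2 * L + 1)

/-- The coefficient of `z ^ (n + 1)` in the Heun operator `heunOp` applied to `z ^ n`. -/
def upperCoeff (b : ℕ) (s : ℝ) (μ : ℂ) (n : ℕ) : ℂ := (2 * n + b + 1 + μ) ^ 2 - s

/-- The coefficient of `z ^ n` in the Heun operator `heunOp` applied to `z ^ n`, written as minus
the sum of the two off-diagonal coefficients and a remainder, which has positive real part if
`0 ≤ re μ`, `b ≤ L` and `0 < κ`. The difference `L - b` is taken in `ℂ`. -/
def diagCoeff (L b : ℕ) (s κ : ℝ) (μ : ℂ) (n : ℕ) : ℂ :=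
  -(lowerCoeff L n + upperCoeff b s μ n + 2 * μ * (2 * n + b + 1 + 2 * (L - b)) + 2 * κ)

lemma lowerCoeff_zero (L : ℕ) : lowerCoeff L 0 = 0 := by simp [lowerCoeff]

lemma lowerCoeff_nonneg (L n : ℕ) : 0 ≤ lowerCoeff L n := by unfold lowerCoeff; positivity

lemma exists_geometric_bound_lowerCoeff (L b : ℕ) (s : ℝ) (μ : ℂ) :
    ∃ N : ℕ, ∀ n ≥ N, 3 / 2 * ‖upperCoeff b s μ n‖ ≤ lowerCoeff L n := by
  set k : ℝ := b + 1 + ‖μ‖ with hk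
  have hk0 : 0 ≤ k := by positivity
  obtain ⟨N, hN⟩ := exists_nat_ge (10 * k + |s| + 10)
  refine ⟨N, fun n hn => ?_⟩
  have hn' : 10 * k + |s| + 10 ≤ (n : ℝ) := hN.trans (by exact_mod_cast hn)
  have h1 : ‖upperCoeff b s μ n‖ ≤ (2 * n + k) ^ 2 + |s| := by
    unfold upperCoeff
    refine (norm_sub_le _ _).trans (add_le_add ?_ (by simp))
    rw [norm_pow]
    gcongr
    calc ‖(2 * n + b + 1 + μ : ℂ)‖ ≤ ‖((2 * n + b + 1 : ℕ) : ℂ)‖ + ‖μ‖ := by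
          push_cast; exact norm_add_le _ _
      _ = 2 * n + k := by rw [Complex.norm_natCast]; push_cast; rw [hk]; ring
  have h2 : (8 : ℝ) * n ^ 2 ≤ lowerCoeff L n := by
    unfold lowerCoeff
    have : (0 : ℝ) ≤ n * L := by positivity
    have : (0 : ℝ) ≤ n := by positivity
    nlinarith
  have h3 : (2 * n + k) ^ 2 ≤ (2.1 * n : ℝ) ^ 2 := by
    gcongr
    have := abs_nonneg s
    linarith
  have h4 : |s| ≤ 0.1 * (n : ℝ) ^ 2 := by
    have := abs_nonneg s
    nlinarith
  nlinarith

/-- A linearly bounded sequence annihilated by a three-term recurrence with strictly dominant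
diagonal vanishes, provided that it starts out nondecreasing in norm and that the lower coefficient
eventually exceeds the upper one by the factor `3 / 2`: the norms can only increase, and their
increments grow geometrically. At `n = 0` the natural subtraction `n - 1` never matters, since the
recurrence is used only for `n > n₀`. -/
lemma eq_zero_of_dominant_recurrence {M : ℕ → ℂ} {A : ℕ → ℝ} {B C : ℕ → ℂ} {n₀ N : ℕ} {K : ℝ}
    (hA : ∀ n, 0 ≤ A n)
    (hrec : ∀ n > n₀, A n * M (n - 1) + B n * M n + C n * M (n + 1) = 0)
    (hdom : ∀ n > n₀, A n + ‖C n‖ < ‖B n‖)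
    (hbase : ‖M n₀‖ ≤ ‖M (n₀ + 1)‖)
    (hgeom : ∀ n ≥ N, 3 / 2 * ‖C n‖ ≤ A n)
    (hgrow : ∀ n, ‖M n‖ ≤ K * (n + 1)) :
    ∀ n ≥ n₀, M n = 0 := by
  have hstep : ∀ n > n₀, ‖B n‖ * ‖M n‖ ≤ A n * ‖M (n - 1)‖ + ‖C n‖ * ‖M (n + 1)‖ := by
    intro n hn
    have h : B n * M n = -(A n * M (n - 1) + C n * M (n + 1)) := by
      linear_combination hrec n hn
    calc ‖B n‖ * ‖M n‖ = ‖A n * M (n - 1) + C n * M (n + 1)‖ := by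
          rw [← norm_mul, h, norm_neg]
      _ ≤ _ := by
          refine (norm_add_le _ _).trans (le_of_eq ?_)
          rw [norm_mul, norm_mul, Complex.norm_real, Real.norm_of_nonneg (hA n)]
  -- once `‖M n‖` does not decrease, dominance of the diagonal keeps it from decreasing
  have hmono : ∀ n ≥ n₀, ‖M n‖ ≤ ‖M (n + 1)‖ := by
    intro n hn
    induction n, hn using Nat.le_induction with
    | base => exact hbase
    | succ n hn ih =>
      have h1 := hstep (n + 1) (by omega)
      have h2 := hdom (n + 1) (by omega)
      simp only [Nat.add_sub_cancel] at h1
      by_contra! hlt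
      have hpos : 0 < ‖M (n + 1)‖ := (norm_nonneg _).trans_lt hlt
      have := mul_le_mul_of_nonneg_left ih (hA (n + 1))
      have := mul_le_mul_of_nonneg_left hlt.le (norm_nonneg (C (n + 1)))
      nlinarith
  have hmono' : ∀ n ≥ n₀, ∀ k, ‖M n‖ ≤ ‖M (n + k)‖ := by
    intro n hn k
    induction k with
    | zero => simp
    | succ k ih => exact ih.trans (hmono (n + k) (by omega))
  by_contra! hne
  obtain ⟨p, hp, hMp⟩ := hne
  set q := p + N + 1 with hq
  have hMq : ∀ n ≥ p, 0 < ‖M n‖ := by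
    intro n hn
    obtain ⟨k, rfl⟩ := Nat.exists_eq_add_of_le hn
    exact (norm_pos_iff.2 hMp).trans_le (hmono' p hp k)
  -- beyond a nonzero term the increments of `‖M n‖` are positive and grow by the factor `3 / 2`
  have hstrict : ∀ n ≥ q, 0 < ‖M (n + 1)‖ - ‖M n‖ ∧
      3 / 2 * (‖M n‖ - ‖M (n - 1)‖) ≤ ‖M (n + 1)‖ - ‖M n‖ := by
    intro n hn
    have h1 := hstep n (by omega)
    have h2 := hdom n (by omega)
    have h3 := hMq n (by omega)
    have h4 := hmono (n - 1) (by omega)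
    rw [Nat.sub_add_cancel (by omega)] at h4
    have h5 := hgeom n (by omega)
    have h6 := mul_le_mul_of_nonneg_left h4 (hA n)
    have h7 : ‖C n‖ * ‖M n‖ + A n * (‖M n‖ - ‖M (n - 1)‖) < ‖C n‖ * ‖M (n + 1)‖ := by nlinarith
    have hC : 0 < ‖C n‖ := by
      rcases (norm_nonneg (C n)).eq_or_lt with h | h
      · rw [← h] at h7; nlinarith
      · exact h
    have h8 : 3 / 2 * ‖C n‖ * (‖M n‖ - ‖M (n - 1)‖) ≤ A n * (‖M n‖ - ‖M (n - 1)‖) :=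
      mul_le_mul_of_nonneg_right h5 (by linarith)
    refine ⟨?_, ?_⟩
    · by_contra! hle
      nlinarith
    · by_contra! hlt
      nlinarith [mul_lt_mul_of_pos_left hlt hC]
  have hexp : ∀ j, (3 / 2 : ℝ) ^ j * (‖M (q + 1)‖ - ‖M q‖) ≤ ‖M (q + j + 1)‖ - ‖M (q + j)‖ := by
    intro j
    induction j with
    | zero => simp
    | succ j ih =>
      have h := (hstrict (q + (j + 1)) (by omega)).2
      have e : q + (j + 1) - 1 = q + j := by omega
      rw [e] at h
      have e' : q + (j + 1) = q + j + 1 := by omega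
      rw [e'] at h ⊢
      rw [pow_succ]
      linarith
  set D := ‖M (q + 1)‖ - ‖M q‖ with hD
  have hDpos : 0 < D := (hstrict q le_rfl).1
  -- geometric growth of the increments contradicts the linear bound
  have hlim : Filter.Tendsto (fun j : ℕ => (K * (q + 2)) * ((1 : ℝ) / (3 / 2) ^ j)
      + K * ((j : ℝ) ^ 1 / (3 / 2) ^ j)) Filter.atTop (nhds 0) := by
    have h1 := (tendsto_pow_const_div_const_pow_of_one_lt 1 (r := (3 / 2 : ℝ))
      (by norm_num)).const_mul K
    have h2 := (tendsto_pow_const_div_const_pow_of_one_lt 0 (r := (3 / 2 : ℝ))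
      (by norm_num)).const_mul (K * (q + 2))
    simpa using h2.add h1
  obtain ⟨j, hj⟩ := (hlim.eventually (gt_mem_nhds hDpos)).exists
  have hpow : (0 : ℝ) < (3 / 2) ^ j := by positivity
  have h1 := hexp j
  have h2 := hgrow (q + j + 1)
  have h3 := norm_nonneg (M (q + j))
  have h4 : (3 / 2 : ℝ) ^ j * D ≤ K * (q + j + 2) := by
    push_cast at h2
    linarith [show K * ((q : ℝ) + j + 1 + 1) = K * (q + j + 2) by ring]
  have h5 : K * (q + 2) * ((1 : ℝ) / (3 / 2) ^ j) + K * ((j : ℝ) ^ 1 / (3 / 2) ^ j)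
      = K * (q + j + 2) / (3 / 2) ^ j := by field_simp; ring
  rw [h5, div_lt_iff₀ hpow] at hj
  linarith

/-! ### Dominance of the diagonal coefficient -/

/-- Strict dominance of the diagonal in the half-plane `0 ≤ re μ`. With `Y = y + re μ`, `τ = im μ`,
`R = re ((y + μ) ^ 2 - s)` and `t = y ^ 2 / (y ^ 2 - s)`, the point is the bound
`‖(y + μ) ^ 2 - s‖ ≤ R + 2 τ ^ 2 t`; after squaring, the remaining terms in `τ ^ 2` are controlled by
the last hypothesis. -/
lemma dominant_of_pos {y y' s κ a : ℝ} {μ : ℂ} (hμ : 0 ≤ μ.re) (hy : 0 < y) (hy' : 0 ≤ y')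
    (hs : 0 ≤ s) (hsy : s < y ^ 2) (hκ : 0 < κ) (ha : 0 ≤ a)
    (h : κ * (y ^ 2 - s) + a * y ^ 2 ≤ (2 * y * y' + y' ^ 2) * (y ^ 2 - s)) :
    a + ‖(y + μ) ^ 2 - (s : ℂ)‖ < ‖a + ((y + μ) ^ 2 - (s : ℂ)) + 2 * μ * y' + 2 * κ‖ := by
  set σ := μ.re with hσ
  set τ := μ.im with hτ
  set Y := y + σ with hY
  set c := ‖(y + μ) ^ 2 - (s : ℂ)‖ with hc
  set R := Y ^ 2 - τ ^ 2 - s with hR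
  set e := 2 * κ + 2 * σ * y' with he
  have hc2 : c ^ 2 = R ^ 2 + 4 * τ ^ 2 * Y ^ 2 := by
    rw [hc, Complex.sq_norm, Complex.normSq_apply]
    simp [pow_two, ← hσ, ← hτ]
    ring
  have hσy : 0 ≤ σ * y' := mul_nonneg hμ hy'
  have he0 : 0 < e := by linarith
  have hYy : y ^ 2 ≤ Y ^ 2 := by gcongr; linarith
  have hd : 0 < y ^ 2 - s := by linarith
  -- `t = y ^ 2 / (y ^ 2 - s)`
  obtain ⟨t, ht⟩ : ∃ t, t * (y ^ 2 - s) = y ^ 2 := ⟨y ^ 2 / (y ^ 2 - s), by field_simp⟩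
  have ht1 : 1 ≤ t := by
    by_contra! hlt
    nlinarith
  have htY : Y ^ 2 ≤ t * (Y ^ 2 - s) := by nlinarith
  have hat : κ + a * t ≤ 2 * y * y' + y' ^ 2 := by
    by_contra! hlt
    nlinarith
  have hτ2 : 0 ≤ τ ^ 2 := sq_nonneg τ
  have hτt : τ ^ 2 ≤ τ ^ 2 * t := le_mul_of_one_le_right hτ2 ht1
  have hcR : c ≤ R + 2 * τ ^ 2 * t := by
    refine le_of_sq_le_sq ?_ (by linarith)
    have h1 : τ ^ 2 * Y ^ 2 ≤ τ ^ 2 * (t * (Y ^ 2 - s)) := mul_le_mul_of_nonneg_left htY hτ2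
    have h2 : 0 ≤ τ ^ 2 * τ ^ 2 * (t * (t - 1)) := by
      have : 0 ≤ t - 1 := by linarith
      positivity
    rw [hc2]
    nlinarith
  have hac : a * c ≤ a * R + 2 * τ ^ 2 * (a * t) := by
    have := mul_le_mul_of_nonneg_left hcR ha
    linarith
  have hat' : τ ^ 2 * (κ + a * t) ≤ τ ^ 2 * (2 * y * y' + y' ^ 2) :=
    mul_le_mul_of_nonneg_left hat hτ2
  have hB : ‖a + ((y + μ) ^ 2 - (s : ℂ)) + 2 * μ * y' + 2 * κ‖ ^ 2
      = (a + R + e) ^ 2 + 4 * τ ^ 2 * (Y + y') ^ 2 := by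
    rw [Complex.sq_norm, Complex.normSq_apply]
    simp [pow_two, ← hσ, ← hτ]
    ring
  refine lt_of_pow_lt_pow_left₀ 2 (norm_nonneg _) ?_
  have h1 : 0 ≤ a * e := by positivity
  have h2 : 0 < e * (Y ^ 2 - s) := mul_pos he0 (by linarith)
  have h3 : 0 ≤ τ ^ 2 * (σ * y') := by positivity
  have h4 : 0 ≤ e ^ 2 := by positivity
  have h5 : (a + R + e) ^ 2 + 4 * τ ^ 2 * (Y + y') ^ 2 - (a + c) ^ 2
      = 2 * (a * R - a * c + 2 * τ ^ 2 * (a * t)) + 2 * (a * e) + 2 * (e * (Y ^ 2 - s)) + e ^ 2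
        + 4 * (τ ^ 2 * (2 * y * y' + y' ^ 2) - τ ^ 2 * (κ + a * t)) + 4 * (τ ^ 2 * (σ * y')) := by
    rw [add_sq a c, hc2, hR, he, hY]
    ring
  rw [hB]
  linarith

/-- The case `a = 0` of `dominant_of_pos`, in which `s = y ^ 2` is allowed. -/
lemma dominant_of_zero {y y' s κ : ℝ} {μ : ℂ} (hμ : 0 ≤ μ.re) (hy : 0 < y) (hy' : 0 ≤ y')
    (hsy : s ≤ y ^ 2) (hκ : 0 < κ) (h : κ ≤ 2 * y * y' + y' ^ 2) :
    ‖(y + μ) ^ 2 - (s : ℂ)‖ < ‖((y + μ) ^ 2 - (s : ℂ)) + 2 * μ * y' + 2 * κ‖ := by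
  set σ := μ.re with hσ
  set τ := μ.im with hτ
  set Y := y + σ with hY
  set R := Y ^ 2 - τ ^ 2 - s with hR
  set e := 2 * κ + 2 * σ * y' with he
  have hσy : 0 ≤ σ * y' := mul_nonneg hμ hy'
  have hYy : y ^ 2 ≤ Y ^ 2 := by gcongr; linarith
  have he0 : 0 < e := by linarith
  have hτ2 : 0 ≤ τ ^ 2 := sq_nonneg τ
  have h1 : ‖(y + μ) ^ 2 - (s : ℂ)‖ ^ 2 = R ^ 2 + 4 * τ ^ 2 * Y ^ 2 := by
    rw [Complex.sq_norm, Complex.normSq_apply]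
    simp [pow_two, ← hσ, ← hτ]
    ring
  have h2 : ‖((y + μ) ^ 2 - (s : ℂ)) + 2 * μ * y' + 2 * κ‖ ^ 2
      = (R + e) ^ 2 + 4 * τ ^ 2 * (Y + y') ^ 2 := by
    rw [Complex.sq_norm, Complex.normSq_apply]
    simp [pow_two, ← hσ, ← hτ]
    ring
  refine lt_of_pow_lt_pow_left₀ 2 (norm_nonneg _) ?_
  rw [h1, h2]
  have h3 : 0 ≤ e * (Y ^ 2 - s) := mul_nonneg he0.le (by linarith)
  have h4 : 0 ≤ τ ^ 2 * (σ * y') := by positivity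
  have h5 : τ ^ 2 * κ ≤ τ ^ 2 * (2 * y * y' + y' ^ 2) := mul_le_mul_of_nonneg_left h hτ2
  have h6 : 0 < e ^ 2 := by positivity
  nlinarith

/-! ### Solutions of the recurrence of linear growth -/

/-- The transposed three-term recurrence of the Heun operator with parameters `L`, `b`, `s`, `κ` has,
for every `μ` in the half-plane `0 ≤ re μ`, no nonzero solution of at most linear growth. The value
`M (n - 1)` at `n = 0` is immaterial because `lowerCoeff L 0 = 0`. -/
def RecurrenceRigid (L b : ℕ) (s κ : ℝ) : Prop :=
  ∀ (μ : ℂ), 0 ≤ μ.re → ∀ (M : ℕ → ℂ) (K : ℝ), (∀ n : ℕ, ‖M n‖ ≤ K * (n + 1)) →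
    (∀ n, lowerCoeff L n * M (n - 1) + diagCoeff L b s κ μ n * M n
      + upperCoeff b s μ n * M (n + 1) = 0) →
    ∀ n, M n = 0

lemma dominant_coeff {L b : ℕ} {s κ : ℝ} {n : ℕ} {μ : ℂ} (hμ : 0 ≤ μ.re) (hbL : b ≤ L)
    (hs : 0 ≤ s) (hsy : s < (2 * n + b + 1 : ℝ) ^ 2) (hκ : 0 < κ)
    (h : κ * ((2 * n + b + 1 : ℝ) ^ 2 - s) + lowerCoeff L n * (2 * n + b + 1 : ℝ) ^ 2 ≤
      (2 * (2 * n + b + 1) * (2 * n + b + 1 + 2 * (L - b)) + (2 * n + b + 1 + 2 * (L - b)) ^ 2)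
        * ((2 * n + b + 1 : ℝ) ^ 2 - s)) :
    lowerCoeff L n + ‖upperCoeff b s μ n‖ < ‖diagCoeff L b s κ μ n‖ := by
  have hbL' : (b : ℝ) ≤ L := by exact_mod_cast hbL
  have := dominant_of_pos (y := 2 * n + b + 1) (y' := 2 * n + b + 1 + 2 * (L - b)) hμ
    (by positivity) (by have : (0 : ℝ) ≤ L - b := by linarith
                        positivity) hs hsy hκ (lowerCoeff_nonneg L n) h
  rw [diagCoeff, norm_neg, upperCoeff]
  push_cast at this
  exact this

lemma dominant_coeff_zero {L b : ℕ} {s κ : ℝ} {μ : ℂ} (hμ : 0 ≤ μ.re) (hbL : b ≤ L)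
    (hsy : s ≤ (b + 1 : ℝ) ^ 2) (hκ : 0 < κ) (h : κ ≤ 3 * (b + 1 : ℝ) ^ 2) :
    ‖upperCoeff b s μ 0‖ < ‖diagCoeff L b s κ μ 0‖ := by
  have hbL' : (0 : ℝ) ≤ L - b := by
    have : (b : ℝ) ≤ L := by exact_mod_cast hbL
    linarith
  have hb : (0 : ℝ) ≤ b := by positivity
  have := dominant_of_zero (y := b + 1) (y' := b + 1 + 2 * (L - b)) hμ
    (by positivity) (by positivity) hsy hκ (by nlinarith)
  rw [diagCoeff, norm_neg, upperCoeff, lowerCoeff_zero]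
  push_cast at this
  simpa using this

lemma recurrenceRigid_of_dominant {L b : ℕ} {s κ : ℝ} (hbL : b ≤ L) (hs : 0 ≤ s)
    (hsy : s ≤ (b + 1 : ℝ) ^ 2) (hκ : 0 < κ) (hκb : κ ≤ 3 * (b + 1 : ℝ) ^ 2)
    (h : ∀ n : ℕ, 0 < n →
      κ * ((2 * n + b + 1 : ℝ) ^ 2 - s) + lowerCoeff L n * (2 * n + b + 1 : ℝ) ^ 2 ≤
      (2 * (2 * n + b + 1) * (2 * n + b + 1 + 2 * (L - b)) + (2 * n + b + 1 + 2 * (L - b)) ^ 2)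
        * ((2 * n + b + 1 : ℝ) ^ 2 - s)) :
    RecurrenceRigid L b s κ := by
  intro μ hμ M K hK hrec
  obtain ⟨N, hN⟩ := exists_geometric_bound_lowerCoeff L b s μ
  have h0 := dominant_coeff_zero (μ := μ) hμ hbL hsy hκ hκb
  have hbase : ‖M 0‖ ≤ ‖M 1‖ := by
    have e : diagCoeff L b s κ μ 0 * M 0 = -(upperCoeff b s μ 0 * M 1) := by
      have := hrec 0
      rw [lowerCoeff_zero] at this
      simp only [Complex.ofReal_zero, zero_mul, zero_add] at this
      linear_combination this
    have e' := congrArg norm e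
    rw [norm_neg, norm_mul, norm_mul] at e'
    by_contra! hlt
    nlinarith [norm_nonneg (M 1), norm_nonneg (upperCoeff b s μ 0)]
  refine fun n => eq_zero_of_dominant_recurrence (n₀ := 0) (lowerCoeff_nonneg L)
    (fun n _ => hrec n) (fun n hn => dominant_coeff hμ hbL hs ?_ hκ (h n hn)) hbase hN hK n
    n.zero_le
  refine hsy.trans_lt ?_
  have : (0 : ℝ) < n := by exact_mod_cast hn
  gcongr
  linarith

lemma recurrenceRigid_generic {l : ℕ} {κ : ℝ} (hl : 2 ≤ l) (hκ : 0 < κ)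
    (hκl : κ ≤ l ^ 2 + 3 * l) : RecurrenceRigid l l 9 κ := by
  have hl' : (2 : ℝ) ≤ l := by exact_mod_cast hl
  refine recurrenceRigid_of_dominant le_rfl (by norm_num) (by nlinarith) hκ (by nlinarith) ?_
  intro n hn
  have hn' : (1 : ℝ) ≤ n := by exact_mod_cast hn
  obtain ⟨y, hy⟩ : ∃ y : ℝ, y = 2 * n + l + 1 := ⟨_, rfl⟩
  have hA : lowerCoeff l n = 2 * (y ^ 2 - y - l * (l + 1)) := by
    rw [lowerCoeff, hy]; ring
  rw [hA, ← hy]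
  have hy5 : 5 ≤ y := by linarith
  have h1 : 0 ≤ y ^ 2 * (l ^ 2 + 3 * l - κ) := mul_nonneg (by positivity) (by linarith)
  have h2 : 0 ≤ y ^ 2 * (l * (l - 1) - 2) := mul_nonneg (by positivity) (by nlinarith)
  have h3 : 0 ≤ y ^ 2 * (y ^ 2 + 2 * y - 25) := mul_nonneg (by positivity) (by nlinarith)
  nlinarith

lemma recurrenceRigid_one_zero : RecurrenceRigid 2 2 1 2 := by
  refine recurrenceRigid_of_dominant le_rfl ?_ ?_ ?_ ?_ ?_ <;> norm_num [lowerCoeff]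
  intro n hn
  have : (0 : ℝ) ≤ n := by positivity
  ring_nf
  nlinarith [pow_nonneg this 2, pow_nonneg this 3, pow_nonneg this 4]

lemma recurrenceRigid_one_one : RecurrenceRigid 2 1 1 2 := by
  refine recurrenceRigid_of_dominant ?_ ?_ ?_ ?_ ?_ ?_ <;> norm_num [lowerCoeff]
  intro n hn
  have : (0 : ℝ) ≤ n := by positivity
  ring_nf
  nlinarith [pow_nonneg this 2, pow_nonneg this 3, pow_nonneg this 4]

lemma recurrenceRigid_two_one : RecurrenceRigid 3 3 1 6 := by
  refine recurrenceRigid_of_dominant le_rfl ?_ ?_ ?_ ?_ ?_ <;> norm_num [lowerCoeff]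
  intro n hn
  have : (0 : ℝ) ≤ n := by positivity
  ring_nf
  nlinarith [pow_nonneg this 2, pow_nonneg this 3, pow_nonneg this 4]

/-- The parameters of `(l, m) = (1, 2)`. Here the diagonal does not dominate in the row `n = 0` (for
`μ = 0` that row reads `-3 M 0 - 5 M 1 = 0`); eliminating `M 0` between the rows `n = 0` and `n = 1`
gives `‖M 1‖ ≤ ‖M 2‖`, and from there on the general argument applies. -/
lemma recurrenceRigid_one_two : RecurrenceRigid 1 1 9 4 := by
  intro μ hμ M K hK hrec
  obtain ⟨N, hN⟩ := exists_geometric_bound_lowerCoeff 1 1 9 μ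
  set σ := μ.re with hσ
  set τ := μ.im with hτ
  have e0 : (μ ^ 2 + 8 * μ + 3) * M 0 = (μ ^ 2 + 4 * μ - 5) * M 1 := by
    have := hrec 0
    norm_num [lowerCoeff, diagCoeff, upperCoeff] at this
    linear_combination -this
  have e1 : 20 * M 0 - (μ ^ 2 + 16 * μ + 35) * M 1 + (μ ^ 2 + 8 * μ + 7) * M 2 = 0 := by
    have := hrec 1
    norm_num [lowerCoeff, diagCoeff, upperCoeff] at this
    linear_combination this
  have hB0 : μ ^ 2 + 8 * μ + 3 ≠ 0 := by
    intro h
    have hre := congrArg Complex.re h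
    have him := congrArg Complex.im h
    simp [pow_two, ← hσ, ← hτ] at hre him
    have h1 : τ * (2 * σ + 8) = 0 := by linarith
    rcases mul_eq_zero.1 h1 with h | h
    · rw [h] at hre; nlinarith
    · linarith
  have e2 : (μ ^ 4 + 24 * μ ^ 3 + 146 * μ ^ 2 + 248 * μ + 205) * M 1
      = (μ ^ 4 + 16 * μ ^ 3 + 74 * μ ^ 2 + 80 * μ + 21) * M 2 := by
    linear_combination 20 * e0 - (μ ^ 2 + 8 * μ + 3) * e1
  -- with `μ = σ + i τ`, the difference of the squared norms is `hpos` below; its only negative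
  -- coefficient, that of `τ ^ 2`, is absorbed into `824 * (τ ^ 2 - 1) ^ 2`
  have hPQ : ‖μ ^ 4 + 16 * μ ^ 3 + 74 * μ ^ 2 + 80 * μ + 21‖
      < ‖μ ^ 4 + 24 * μ ^ 3 + 146 * μ ^ 2 + 248 * μ + 205‖ := by
    refine lt_of_pow_lt_pow_left₀ 2 (norm_nonneg _) ?_
    rw [Complex.sq_norm, Complex.sq_norm, Complex.normSq_apply, Complex.normSq_apply, ← sub_pos]
    have hpos : 0 <
      40760 + 824 * (τ ^ 2 - 1) ^ 2 + 6040 * τ ^ 4 + 176 * τ ^ 6 + 98320 * σ + 33072 * σ * τ ^ 2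
        + 3632 * σ * τ ^ 4 + 16 * σ * τ ^ 6 + 111856 * σ ^ 2 + 29472 * σ ^ 2 * τ ^ 2
        + 816 * σ ^ 2 * τ ^ 4 + 69744 * σ ^ 3 + 8608 * σ ^ 3 * τ ^ 2 + 48 * σ ^ 3 * τ ^ 4
        + 25552 * σ ^ 4 + 1104 * σ ^ 4 * τ ^ 2 + 4976 * σ ^ 5 + 48 * σ ^ 5 * τ ^ 2 + 464 * σ ^ 6
        + 16 * σ ^ 7 := by
      positivity
    refine hpos.trans_eq ?_
    simp only [pow_succ, pow_zero, one_mul, Complex.add_re, Complex.add_im, Complex.mul_re,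
      Complex.mul_im, ← hσ, ← hτ, Complex.re_ofNat, Complex.im_ofNat]
    ring
  have hbase : ‖M 1‖ ≤ ‖M 2‖ := by
    have e' := congrArg norm e2
    rw [norm_mul, norm_mul] at e'
    by_contra! hlt
    nlinarith [norm_nonneg (M 2), norm_nonneg (μ ^ 4 + 16 * μ ^ 3 + 74 * μ ^ 2 + 80 * μ + 21)]
  have hM : ∀ n ≥ 1, M n = 0 := by
    refine eq_zero_of_dominant_recurrence (n₀ := 1) (lowerCoeff_nonneg 1)
      (fun n _ => hrec n) (fun n hn => dominant_coeff hμ le_rfl (by norm_num) ?_ (by norm_num) ?_)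
      hbase hN hK
    · have : (2 : ℝ) ≤ n := by exact_mod_cast hn
      push_cast
      nlinarith
    · obtain ⟨k, rfl⟩ := Nat.exists_eq_add_of_le (show 2 ≤ n from hn)
      have : (0 : ℝ) ≤ k := by positivity
      norm_num [lowerCoeff]
      ring_nf
      nlinarith [pow_nonneg this 2, pow_nonneg this 3, pow_nonneg this 4]
  intro n
  rcases n.eq_zero_or_pos with rfl | hn
  · rw [hM 1 le_rfl, mul_zero] at e0
    exact (mul_eq_zero.1 e0).resolve_left hB0
  · exact hM n hn

/-! ### Finite-part integrals against `(1 - r ^ 2) ^ (μ - 1)` -/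

lemma norm_lightConeWeight_le {μ : ℂ} (hμ : 0 ≤ μ.re) {r : ℝ} (hr : r ∈ Ioo (0 : ℝ) 1) :
    ‖((1 - r ^ 2 : ℝ) : ℂ) ^ μ‖ ≤ 1 := by
  have h : 0 < 1 - r ^ 2 := by nlinarith [hr.1, hr.2]
  rw [Complex.norm_cpow_eq_rpow_re_of_pos h]
  exact Real.rpow_le_one h.le (by nlinarith [hr.1]) hμ

lemma lightConeWeight_sub_one {μ : ℂ} {r : ℝ} (hr : r ∈ Ioo (0 : ℝ) 1) :
    ((1 - r ^ 2 : ℝ) : ℂ) ^ μ = ((1 - r ^ 2 : ℝ) : ℂ) ^ (μ - 1) * ((1 - r ^ 2 : ℝ) : ℂ) := by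
  have h : 0 < 1 - r ^ 2 := by nlinarith [hr.1, hr.2]
  have h' : ((1 - r ^ 2 : ℝ) : ℂ) ≠ 0 := by exact_mod_cast h.ne'
  conv_lhs => rw [← sub_add_cancel μ 1, Complex.cpow_add _ _ h', Complex.cpow_one]

lemma norm_lightConeWeight_sub_one_mul_le {μ : ℂ} (hμ : 0 ≤ μ.re) {r : ℝ}
    (hr : r ∈ Ioo (0 : ℝ) 1) : ‖((1 - r ^ 2 : ℝ) : ℂ) ^ (μ - 1)‖ * (1 - r) ≤ 1 := by
  have h := norm_lightConeWeight_le hμ hr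
  rw [lightConeWeight_sub_one hr, norm_mul, Complex.norm_real, Real.norm_of_nonneg
    (by nlinarith [hr.1, hr.2])] at h
  refine le_trans ?_ h
  gcongr
  nlinarith [hr.1, hr.2]

lemma hasDerivAt_lightConeWeight {μ : ℂ} {r : ℝ} (hr : r ∈ Ioo (0 : ℝ) 1) :
    HasDerivAt (fun r : ℝ => ((1 - r ^ 2 : ℝ) : ℂ) ^ μ)
      (-2 * μ * r * ((1 - r ^ 2 : ℝ) : ℂ) ^ (μ - 1)) r := by
  have h : 0 < 1 - r ^ 2 := by nlinarith [hr.1, hr.2]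
  have h1 : HasDerivAt (fun r : ℝ => 1 - r ^ 2) (-(2 * r)) r := by
    simpa using (hasDerivAt_pow 2 r).const_sub 1
  have h2 : HasDerivAt (fun w : ℂ => w ^ μ) (μ * ((1 - r ^ 2 : ℝ) : ℂ) ^ (μ - 1))
      ((1 - r ^ 2 : ℝ) : ℂ) := by
    have := (hasDerivAt_id ((1 - r ^ 2 : ℝ) : ℂ)).cpow_const (c := μ)
      (Or.inl (by simpa only [id, Complex.ofReal_re] using h))
    simpa using this
  have h3 := h2.comp r h1.ofReal_comp
  refine h3.congr_deriv ?_
  push_cast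
  ring

lemma exists_norm_sub_one_le {h : ℝ → ℂ} (hh : ContDiffOn ℝ 1 h (Icc 0 1)) :
    ∃ K, 0 ≤ K ∧ ∀ r ∈ Icc (0 : ℝ) 1, ‖h r - h 1‖ ≤ K * (1 - r) := by
  have hc : ContinuousOn (derivWithin h (Icc 0 1)) (Icc 0 1) :=
    hh.continuousOn_derivWithin (uniqueDiffOn_Icc zero_lt_one) le_rfl
  obtain ⟨K, hK⟩ := isCompact_Icc.exists_bound_of_continuousOn hc
  refine ⟨K, (norm_nonneg _).trans (hK 0 (by simp)), fun r hr => ?_⟩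
  have := (convex_Icc (0 : ℝ) 1).norm_image_sub_le_of_norm_derivWithin_le
    (hh.differentiableOn one_ne_zero) hK (right_mem_Icc.2 zero_le_one) hr
  rwa [Real.norm_eq_abs, abs_sub_comm, abs_of_nonneg (by linarith [hr.2])] at this

/-- The Hadamard finite part of `∫₀¹ h r (1 - r ^ 2) ^ (μ - 1) dr`, obtained by subtracting `h 1 * r`
and adding back `h 1 * ∫₀¹ r (1 - r ^ 2) ^ (μ - 1) dr = h 1 / (2 μ)`. It is the integral itself for
`0 < re μ` and continues it to the rest of the closed half-plane `0 ≤ re μ`, except `μ = 0`, where the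
last term is a junk value. -/
noncomputable def finitePart (μ : ℂ) (h : ℝ → ℂ) : ℂ :=
  (∫ r in (0 : ℝ)..1, (h r - h 1 * r) * ((1 - r ^ 2 : ℝ) : ℂ) ^ (μ - 1)) + h 1 / (2 * μ)

lemma norm_finitePart_integrand_le {μ : ℂ} (hμ : 0 ≤ μ.re) {h : ℝ → ℂ} {K : ℝ}
    (hK : ∀ r ∈ Icc (0 : ℝ) 1, ‖h r - h 1‖ ≤ K * (1 - r)) {r : ℝ} (hr : r ∈ Ioo (0 : ℝ) 1) :
    ‖(h r - h 1 * r) * ((1 - r ^ 2 : ℝ) : ℂ) ^ (μ - 1)‖ ≤ K + ‖h 1‖ := by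
  have h1 := hK r (Ioo_subset_Icc_self hr)
  have h2 : ‖h r - h 1 * r‖ ≤ (K + ‖h 1‖) * (1 - r) := by
    calc ‖h r - h 1 * r‖ = ‖(h r - h 1) + h 1 * ((1 - r : ℝ) : ℂ)‖ := by
          congr 1; push_cast; ring
      _ ≤ K * (1 - r) + ‖h 1‖ * (1 - r) := by
          refine (norm_add_le _ _).trans (add_le_add h1 ?_)
          rw [norm_mul, Complex.norm_real, Real.norm_of_nonneg (by linarith [hr.2])]
      _ = _ := by ring
  have h3 : 0 ≤ K + ‖h 1‖ := by
    by_contra! hlt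
    nlinarith [norm_nonneg (h r - h 1 * r), hr.2]
  rw [norm_mul]
  calc _ ≤ (K + ‖h 1‖) * (1 - r) * ‖((1 - r ^ 2 : ℝ) : ℂ) ^ (μ - 1)‖ := by gcongr
    _ = (K + ‖h 1‖) * (‖((1 - r ^ 2 : ℝ) : ℂ) ^ (μ - 1)‖ * (1 - r)) := by ring
    _ ≤ (K + ‖h 1‖) * 1 := by
        gcongr; exact norm_lightConeWeight_sub_one_mul_le hμ hr
    _ = _ := mul_one _

lemma continuousOn_lightConeWeight (μ : ℂ) :
    ContinuousOn (fun r : ℝ => ((1 - r ^ 2 : ℝ) : ℂ) ^ μ) (Ioo 0 1) :=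
  fun _ hr => (hasDerivAt_lightConeWeight hr).continuousAt.continuousWithinAt

lemma intervalIntegrable_of_bound_Ioo {f : ℝ → ℂ} {K : ℝ} (hf : ContinuousOn f (Ioo 0 1))
    (hK : ∀ r ∈ Ioo (0 : ℝ) 1, ‖f r‖ ≤ K) :
    IntervalIntegrable f MeasureTheory.volume 0 1 := by
  rw [intervalIntegrable_iff_integrableOn_Ioo_of_le zero_le_one]
  exact MeasureTheory.IntegrableOn.of_bound (by simp) (hf.aestronglyMeasurable measurableSet_Ioo) K
    ((MeasureTheory.ae_restrict_iff' measurableSet_Ioo).2 (Filter.Eventually.of_forall hK))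

lemma intervalIntegrable_finitePart {μ : ℂ} (hμ : 0 ≤ μ.re) {h : ℝ → ℂ}
    (hh : ContDiffOn ℝ 1 h (Icc 0 1)) :
    IntervalIntegrable (fun r : ℝ => (h r - h 1 * r) * ((1 - r ^ 2 : ℝ) : ℂ) ^ (μ - 1))
      MeasureTheory.volume 0 1 := by
  obtain ⟨K, -, hK⟩ := exists_norm_sub_one_le hh
  refine intervalIntegrable_of_bound_Ioo ?_ fun r hr => norm_finitePart_integrand_le hμ hK hr
  refine ContinuousOn.mul ?_ (continuousOn_lightConeWeight _)
  exact (hh.continuousOn.mono Ioo_subset_Icc_self).sub (by fun_prop)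

lemma norm_finitePart_le {μ : ℂ} (hμ : 0 ≤ μ.re) {h : ℝ → ℂ} {K : ℝ}
    (hK : ∀ r ∈ Icc (0 : ℝ) 1, ‖h r - h 1‖ ≤ K * (1 - r)) :
    ‖finitePart μ h‖ ≤ K + ‖h 1‖ + ‖h 1 / (2 * μ)‖ := by
  refine (norm_add_le _ _).trans (add_le_add ?_ le_rfl)
  have := intervalIntegral.norm_integral_le_of_norm_le_const_ae (a := (0 : ℝ)) (b := 1)
    (C := K + ‖h 1‖)
    (f := fun r : ℝ => (h r - h 1 * r) * ((1 - r ^ 2 : ℝ) : ℂ) ^ (μ - 1)) ?_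
  · simpa using this
  · filter_upwards [MeasureTheory.Measure.ae_ne MeasureTheory.volume (1 : ℝ)] with r hr1 hr
    rw [uIoc_of_le zero_le_one] at hr
    exact norm_finitePart_integrand_le hμ hK ⟨hr.1, lt_of_le_of_ne hr.2 hr1⟩

lemma finitePart_congr (μ : ℂ) {h k : ℝ → ℂ} (hhk : EqOn h k (Icc 0 1)) :
    finitePart μ h = finitePart μ k := by
  unfold finitePart
  rw [hhk (right_mem_Icc.2 zero_le_one)]
  congr 1
  refine intervalIntegral.integral_congr fun r hr => ?_
  rw [uIcc_of_le zero_le_one] at hr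
  simp only [hhk hr]

lemma finitePart_add {μ : ℂ} (hμ : 0 ≤ μ.re) {h k : ℝ → ℂ} (hh : ContDiffOn ℝ 1 h (Icc 0 1))
    (hk : ContDiffOn ℝ 1 k (Icc 0 1)) :
    finitePart μ (fun r => h r + k r) = finitePart μ h + finitePart μ k := by
  unfold finitePart
  rw [add_add_add_comm, ← intervalIntegral.integral_add (intervalIntegrable_finitePart hμ hh)
    (intervalIntegrable_finitePart hμ hk), add_div]
  congr 2
  ext r
  ring

lemma finitePart_const_mul (μ c : ℂ) (h : ℝ → ℂ) :
    finitePart μ (fun r => c * h r) = c * finitePart μ h := by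
  unfold finitePart
  rw [mul_add, ← intervalIntegral.integral_const_mul, mul_div_assoc]
  congr 2
  ext r
  ring

/-- If `h 1 = 0`, the finite part is a convergent integral. -/
lemma finitePart_of_eq_zero (μ : ℂ) {h : ℝ → ℂ} (h1 : h 1 = 0) :
    finitePart μ h = ∫ r in (0 : ℝ)..1, h r * ((1 - r ^ 2 : ℝ) : ℂ) ^ (μ - 1) := by
  simp [finitePart, h1]

/-- Integration by parts for the finite part: the left-hand side is the finite part of the integral
of the derivative of `(1 - r ^ 2) ^ μ * W r`, and no boundary term at `r = 1` survives as long as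
`μ ≠ 0`. -/
lemma finitePart_divergence {μ : ℂ} (hμ : 0 ≤ μ.re) (hμ0 : μ ≠ 0) {W : ℝ → ℂ}
    (hW : ContDiffOn ℝ 2 W (Icc 0 1)) :
    finitePart μ (fun r => (1 - (r : ℂ) ^ 2) * derivWithin W (Icc 0 1) r - 2 * μ * r * W r)
      = -W 0 := by
  have hW1 : ContDiffOn ℝ 1 W (Icc 0 1) := hW.of_le (by norm_num)
  have hD : ContDiffOn ℝ 1 (derivWithin W (Icc 0 1)) (Icc 0 1) :=
    hW.derivWithin (uniqueDiffOn_Icc zero_lt_one) (by norm_num)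
  have hk : ContDiffOn ℝ 1
      (fun r : ℝ => (1 - (r : ℂ) ^ 2) * derivWithin W (Icc 0 1) r - 2 * μ * r * W r)
      (Icc 0 1) := by
    have : ContDiff ℝ 1 (fun r : ℝ => (r : ℂ)) := Complex.ofRealCLM.contDiff
    fun_prop
  obtain ⟨K, hK0, hK⟩ := exists_norm_sub_one_le hW1
  -- `(W r - W 1) (1 - r ^ 2) ^ μ` is an antiderivative of the integrand; its continuity at `r = 1`
  -- comes from the first factor, the second being merely bounded when `re μ = 0`
  have hcont : ContinuousOn (fun r : ℝ => (W r - W 1) * ((1 - r ^ 2 : ℝ) : ℂ) ^ μ) (Icc 0 1) := by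
    intro r hr
    rcases hr.2.eq_or_lt with rfl | hr1
    · unfold ContinuousWithinAt
      simp only [sub_self, zero_mul]
      refine squeeze_zero_norm' (a := fun r => K * (1 - r)) ?_ ?_
      · filter_upwards [self_mem_nhdsWithin] with r hr
        rw [norm_mul]
        have h1 : ‖((1 - r ^ 2 : ℝ) : ℂ) ^ μ‖ ≤ 1 := by
          rcases hr.1.eq_or_lt with rfl | h0
          · simp
          rcases hr.2.eq_or_lt with rfl | h1
          · simp [Complex.zero_cpow hμ0]
          exact norm_lightConeWeight_le hμ ⟨h0, h1⟩
        calc _ ≤ K * (1 - r) * 1 :=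
              mul_le_mul (hK r hr) h1 (norm_nonneg _) (by nlinarith [hr.2])
          _ = _ := mul_one _
      · have : Continuous fun r : ℝ => K * (1 - r) := by fun_prop
        simpa using (this.tendsto 1).mono_left nhdsWithin_le_nhds
    · refine ContinuousWithinAt.mul ((hW1.continuousOn r hr).sub continuousWithinAt_const) ?_
      refine ContinuousAt.continuousWithinAt ?_
      refine ContinuousAt.cpow (by fun_prop) continuousAt_const ?_
      left
      simp only [Complex.ofReal_re]
      nlinarith [hr.1]
  have hderiv : ∀ r ∈ Ioo (0 : ℝ) 1, HasDerivAt
      (fun r : ℝ => (W r - W 1) * ((1 - r ^ 2 : ℝ) : ℂ) ^ μ)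
      (((1 - (r : ℂ) ^ 2) * derivWithin W (Icc 0 1) r - 2 * μ * r * W r
        - ((1 - ((1 : ℝ) : ℂ) ^ 2) * derivWithin W (Icc 0 1) 1 - 2 * μ * ((1 : ℝ) : ℂ) * W 1) * r)
        * ((1 - r ^ 2 : ℝ) : ℂ) ^ (μ - 1)) r := by
    intro r hr
    have h1 : HasDerivAt W (derivWithin W (Icc 0 1) r) r :=
      ((hW1.differentiableOn one_ne_zero) r (Ioo_subset_Icc_self hr)).hasDerivWithinAt.hasDerivAt
        (Icc_mem_nhds hr.1 hr.2)
    refine ((h1.sub_const (W 1)).mul (hasDerivAt_lightConeWeight (μ := μ) hr)).congr_deriv ?_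
    rw [lightConeWeight_sub_one hr (μ := μ)]
    push_cast
    ring
  have hint := intervalIntegral.integral_eq_sub_of_hasDerivAt_of_le zero_le_one hcont hderiv
    (intervalIntegrable_finitePart hμ hk)
  unfold finitePart
  rw [hint]
  have : (2 * μ) ≠ 0 := by simpa using hμ0
  simp
  field_simp
  ring

/-! ### The radial operator and the Heun operator -/

/-- A four-parameter family that contains all potentials `susyPotential l m` with `0 < l` and
`|l - m| ≤ 1`. Here `L` is the exponent of the regular solution at `r = 0`, `b - L` governs the
exponents at `r = ∞` (the value there is `-(L - b) * (L - b + 1)`, with `L - b` taken in `ℝ`), `s`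
those at `r ^ 2 = -1`, and `κ` is the value at `r = 1`. -/
noncomputable def rationalPotential (L b : ℕ) (s κ r : ℝ) : ℝ :=
  (-((L - b) * (L - b + 1)) * r ^ 6 + (2 * κ + s - 1 - L * (L + 1)) * r ^ 4
    + (2 * κ - s + 1 + (L - b) * (L - b + 1)) * r ^ 2 + L * (L + 1)) / (r ^ 2 * (1 + r ^ 2) ^ 2)

/-- The left-hand side of the radial mode equation with potential value `U`, as a function of the
values `u`, `u'`, `u''` of an unknown function and its first two derivatives at `r`. -/
noncomputable def radialOp (U : ℝ) (μ : ℂ) (r : ℝ) (u u' u'' : ℂ) : ℂ :=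
  (1 - (r : ℂ) ^ 2) * u'' + (2 / (r : ℂ) - 2 * (μ + 1) * r) * u' - (μ ^ 2 + μ + U) * u

/-- The Heun operator, cleared of denominators: `4 z (z - 1) (z - 2)` times the left-hand side of the
Heun form of the mode equation, as a function of the values `f`, `f'`, `f''` of an unknown function
and its first two derivatives at `z`. -/
noncomputable def heunOp (L b : ℕ) (s κ : ℝ) (μ z f f' f'' : ℂ) : ℂ :=
  4 * z * (z - 1) * (z - 2) * f''
    + (2 * (2 * L + 3) * (z - 1) * (z - 2) + 4 * μ * z * (z - 2)
      + 2 * (1 - 2 * (L - b)) * z * (z - 1)) * f'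
    + (diagCoeff L b s κ μ 0 + upperCoeff b s μ 0 * z) * f

/-- The coordinate `z = 2 r ^ 2 / (1 + r ^ 2)` of the Heun form, which maps `[0, 1]` onto `[0, 1]`. -/
noncomputable def heunCoord (r : ℝ) : ℝ := 2 * r ^ 2 / (1 + r ^ 2)

/-- The factor `r ^ L * (1 + r ^ 2) ^ (-(b + μ) / 2)` that turns a solution of the Heun form into a
solution of the radial form. -/
noncomputable def modeFactor (L b : ℕ) (μ : ℂ) (r : ℝ) : ℂ :=
  (r : ℂ) ^ L * Complex.exp (-((b + μ) / 2) * (Real.log (1 + r ^ 2) : ℂ))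

lemma contDiff_modeFactor (L b : ℕ) (μ : ℂ) : ContDiff ℝ ∞ (modeFactor L b μ) := by
  have h1 : ContDiff ℝ ∞ (fun r : ℝ => (r : ℂ)) := Complex.ofRealCLM.contDiff
  have h2 : ContDiff ℝ ∞ (fun r : ℝ => (Real.log (1 + r ^ 2) : ℂ)) :=
    Complex.ofRealCLM.contDiff.comp
      (ContDiff.log (by fun_prop) fun r => by positivity)
  unfold modeFactor
  exact (h1.pow L).mul (contDiff_const.mul h2).cexp

lemma modeFactor_ne_zero (L b : ℕ) (μ : ℂ) {r : ℝ} (hr : r ≠ 0) : modeFactor L b μ r ≠ 0 :=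
  mul_ne_zero (pow_ne_zero _ (by exact_mod_cast hr)) (Complex.exp_ne_zero _)

lemma hasDerivAt_modeFactor (L b : ℕ) (μ : ℂ) {r : ℝ} (hr : r ≠ 0) :
    HasDerivAt (modeFactor L b μ)
      (modeFactor L b μ r * (L / r - (b + μ) * r / (1 + (r : ℂ) ^ 2))) r := by
  have hr' : (r : ℂ) ≠ 0 := by exact_mod_cast hr
  have hq : (1 + r ^ 2 : ℝ) ≠ 0 := by positivity
  have hq' : (1 + (r : ℂ) ^ 2) ≠ 0 := by exact_mod_cast hq
  have h1 : HasDerivAt (fun r : ℝ => (r : ℂ) ^ L) (L * (r : ℂ) ^ (L - 1)) r := by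
    simpa using (hasDerivAt_pow L (r : ℂ)).comp_ofReal
  have h2 : HasDerivAt (fun r : ℝ => Real.log (1 + r ^ 2)) (2 * r / (1 + r ^ 2)) r := by
    have := ((hasDerivAt_pow 2 r).const_add 1).log hq
    simpa using this
  have h3 := h1.mul ((h2.ofReal_comp.const_mul (-((b + μ) / 2))).cexp)
  refine h3.congr_deriv ?_
  unfold modeFactor
  push_cast
  rcases L.eq_zero_or_pos with rfl | hL
  · simp; field_simp
  · have : (r : ℂ) ^ L = r ^ (L - 1) * r := by rw [← pow_succ, Nat.sub_add_cancel hL]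
    rw [this]
    field_simp
    ring

lemma hasDerivAt_heunCoord (r : ℝ) : HasDerivAt heunCoord (4 * r / (1 + r ^ 2) ^ 2) r := by
  have hq : (1 + r ^ 2 : ℝ) ≠ 0 := by positivity
  have := ((hasDerivAt_pow 2 r).const_mul 2).div ((hasDerivAt_pow 2 r).const_add 1) hq
  refine this.congr_deriv ?_
  field_simp
  ring

lemma contDiff_heunCoord : ContDiff ℝ ∞ heunCoord :=
  ContDiff.div (by fun_prop) (by fun_prop) fun r => by positivity

lemma heunCoord_mem_Icc {r : ℝ} (hr : r ∈ Icc (0 : ℝ) 1) : heunCoord r ∈ Icc (0 : ℝ) 1 := by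
  unfold heunCoord
  refine ⟨by positivity, (div_le_one (by positivity)).2 ?_⟩
  nlinarith [hr.1, hr.2]

lemma heunCoord_mem_Ioo {r : ℝ} (hr : r ∈ Ioo (0 : ℝ) 1) : heunCoord r ∈ Ioo (0 : ℝ) 1 := by
  have := hr.1
  unfold heunCoord
  refine ⟨by positivity, (div_lt_one (by positivity)).2 ?_⟩
  nlinarith [hr.1, hr.2]

/-- Conjugation with `modeFactor` (whose value is `v`) and the change of variables `heunCoord`
transform the radial operator into the Heun operator: the arguments on the left are the value and
the derivatives of `modeFactor * f ∘ heunCoord`. -/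
lemma radialOp_conj (L b : ℕ) (s κ : ℝ) (μ : ℂ) {r : ℝ} (hr : r ≠ 0) (v f f' f'' : ℂ) :
    radialOp (rationalPotential L b s κ r) μ r (v * f)
      (v * ((L / r - (b + μ) * r / (1 + (r : ℂ) ^ 2)) * f + 4 * r / (1 + (r : ℂ) ^ 2) ^ 2 * f'))
      (v * (((L / r - (b + μ) * r / (1 + (r : ℂ) ^ 2)) ^ 2 - L / (r : ℂ) ^ 2
            - (b + μ) * (1 - (r : ℂ) ^ 2) / (1 + (r : ℂ) ^ 2) ^ 2) * f
          + (2 * (L / r - (b + μ) * r / (1 + (r : ℂ) ^ 2)) * (4 * r / (1 + (r : ℂ) ^ 2) ^ 2)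
            + (4 - 12 * (r : ℂ) ^ 2) / (1 + (r : ℂ) ^ 2) ^ 3) * f'
          + (4 * r / (1 + (r : ℂ) ^ 2) ^ 2) ^ 2 * f''))
      = v / (1 + (r : ℂ) ^ 2) * heunOp L b s κ μ (heunCoord r) f f' f'' := by
  have hr' : (r : ℂ) ≠ 0 := by exact_mod_cast hr
  have hq : (1 + r ^ 2 : ℝ) ≠ 0 := by positivity
  have hq' : (1 + (r : ℂ) ^ 2) ≠ 0 := by exact_mod_cast hq
  simp only [radialOp, heunOp, rationalPotential, heunCoord, diagCoeff, upperCoeff, lowerCoeff]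
  push_cast
  field_simp
  ring

lemma radialOp_modeFactor_mul (L b : ℕ) (s κ : ℝ) (μ : ℂ) {F F' F'' : ℝ → ℂ}
    (hF : ∀ t ∈ Ioo (0 : ℝ) 1, HasDerivAt F (F' t) t)
    (hF' : ∀ t ∈ Ioo (0 : ℝ) 1, HasDerivAt F' (F'' t) t) {r : ℝ} (hr : r ∈ Ioo (0 : ℝ) 1) :
    radialOp (rationalPotential L b s κ r) μ r (modeFactor L b μ r * F (heunCoord r))
        (deriv (fun r => modeFactor L b μ r * F (heunCoord r)) r)
        (deriv (deriv (fun r => modeFactor L b μ r * F (heunCoord r))) r)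
      = modeFactor L b μ r / (1 + (r : ℂ) ^ 2) * heunOp L b s κ μ (heunCoord r)
        (F (heunCoord r)) (F' (heunCoord r)) (F'' (heunCoord r)) := by
  have hcomp : ∀ {G G' : ℝ → ℂ}, (∀ t ∈ Ioo (0 : ℝ) 1, HasDerivAt G (G' t) t) →
      ∀ r ∈ Ioo (0 : ℝ) 1, HasDerivAt (fun r => G (heunCoord r))
        (4 * r / (1 + (r : ℂ) ^ 2) ^ 2 * G' (heunCoord r)) r := by
    intro G G' hG r hr
    have := (hG _ (heunCoord_mem_Ioo hr)).scomp r (hasDerivAt_heunCoord r)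
    refine this.congr_deriv ?_
    rw [Complex.real_smul]
    push_cast
    rfl
  have h1 : ∀ r ∈ Ioo (0 : ℝ) 1, HasDerivAt (fun r => modeFactor L b μ r * F (heunCoord r))
      (modeFactor L b μ r * ((L / r - (b + μ) * r / (1 + (r : ℂ) ^ 2)) * F (heunCoord r)
        + 4 * r / (1 + (r : ℂ) ^ 2) ^ 2 * F' (heunCoord r))) r := by
    intro r hr
    refine ((hasDerivAt_modeFactor L b μ hr.1.ne').mul (hcomp hF r hr)).congr_deriv ?_
    ring
  have hrc : (r : ℂ) ≠ 0 := by exact_mod_cast hr.1.ne'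
  have hq : (1 + r ^ 2 : ℝ) ≠ 0 := by positivity
  have hq' : (1 + (r : ℂ) ^ 2) ≠ 0 := by exact_mod_cast hq
  have hid : HasDerivAt (fun r : ℝ => (r : ℂ)) 1 r := Complex.ofRealCLM.hasDerivAt
  have hsq : HasDerivAt (fun r : ℝ => (1 : ℂ) + (r : ℂ) ^ 2) (2 * (r : ℂ)) r := by
    simpa using (hid.pow 2).const_add (1 : ℂ)
  have h2 : HasDerivAt (fun r : ℝ => modeFactor L b μ r *
      ((L / r - (b + μ) * r / (1 + (r : ℂ) ^ 2)) * F (heunCoord r)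
        + 4 * r / (1 + (r : ℂ) ^ 2) ^ 2 * F' (heunCoord r)))
      (modeFactor L b μ r * (((L / r - (b + μ) * r / (1 + (r : ℂ) ^ 2)) ^ 2 - L / (r : ℂ) ^ 2
            - (b + μ) * (1 - (r : ℂ) ^ 2) / (1 + (r : ℂ) ^ 2) ^ 2) * F (heunCoord r)
          + (2 * (L / r - (b + μ) * r / (1 + (r : ℂ) ^ 2)) * (4 * r / (1 + (r : ℂ) ^ 2) ^ 2)
            + (4 - 12 * (r : ℂ) ^ 2) / (1 + (r : ℂ) ^ 2) ^ 3) * F' (heunCoord r)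
          + (4 * r / (1 + (r : ℂ) ^ 2) ^ 2) ^ 2 * F'' (heunCoord r))) r := by
    have hd : HasDerivAt (fun r : ℝ => L / (r : ℂ) - (b + μ) * r / (1 + (r : ℂ) ^ 2))
        (-L / (r : ℂ) ^ 2 - (b + μ) * (1 - (r : ℂ) ^ 2) / (1 + (r : ℂ) ^ 2) ^ 2) r := by
      refine (((hasDerivAt_const r (L : ℂ)).div hid hrc).sub
        ((hid.const_mul (b + μ)).div hsq hq')).congr_deriv ?_
      field_simp
      ring
    have hz : HasDerivAt (fun r : ℝ => 4 * (r : ℂ) / (1 + (r : ℂ) ^ 2) ^ 2)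
        ((4 - 12 * (r : ℂ) ^ 2) / (1 + (r : ℂ) ^ 2) ^ 3) r := by
      refine ((hid.const_mul 4).div (hsq.pow 2) (pow_ne_zero 2 hq')).congr_deriv ?_
      simp only [Pi.pow_apply]
      field_simp
      ring
    refine ((hasDerivAt_modeFactor L b μ hr.1.ne').mul
      ((hd.mul (hcomp hF r hr)).add (hz.mul (hcomp hF' r hr)))).congr_deriv ?_
    simp only [Pi.mul_apply, Pi.add_apply]
    ring
  have h3 : deriv (fun r => modeFactor L b μ r * F (heunCoord r)) =ᶠ[nhds r]
      (fun r : ℝ => modeFactor L b μ r *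
        ((L / r - (b + μ) * r / (1 + (r : ℂ) ^ 2)) * F (heunCoord r)
          + 4 * r / (1 + (r : ℂ) ^ 2) ^ 2 * F' (heunCoord r))) := by
    filter_upwards [isOpen_Ioo.mem_nhds hr] with r hr using (h1 r hr).deriv
  rw [h3.deriv_eq, h2.deriv, (h1 r hr).deriv, radialOp_conj L b s κ μ hr.1.ne']

/-- The Heun operator is tridiagonal on monomials. -/
lemma heunOp_pow (L b : ℕ) (s κ : ℝ) (μ z : ℂ) (n : ℕ) :
    heunOp L b s κ μ z (z ^ n) (n * z ^ (n - 1)) (n * ((n - 1 : ℕ) * z ^ (n - 1 - 1)))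
      = lowerCoeff L n * z ^ (n - 1) + diagCoeff L b s κ μ n * z ^ n
        + upperCoeff b s μ n * z ^ (n + 1) := by
  simp only [heunOp, diagCoeff, upperCoeff, lowerCoeff]
  rcases n with _ | _ | n
  · simp
  · simp; ring
  · simp only [Nat.add_sub_cancel]
    push_cast
    ring

/-! ### Test functions on which the radial operator is tridiagonal -/

/-- The `n`-th test function, `modeFactor` times the `n`-th power of `heunCoord`. -/
noncomputable def testMode (L b : ℕ) (μ : ℂ) (n : ℕ) (r : ℝ) : ℂ :=
  modeFactor L b μ r * (heunCoord r : ℂ) ^ n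

lemma contDiff_testMode (L b : ℕ) (μ : ℂ) (n : ℕ) : ContDiff ℝ ∞ (testMode L b μ n) :=
  (contDiff_modeFactor L b μ).mul ((Complex.ofRealCLM.contDiff.comp contDiff_heunCoord).pow n)

lemma radialOp_testMode (L b : ℕ) (s κ : ℝ) (μ : ℂ) (n : ℕ) {r : ℝ} (hr : r ∈ Ioo (0 : ℝ) 1) :
    radialOp (rationalPotential L b s κ r) μ r (testMode L b μ n r)
        (deriv (testMode L b μ n) r) (deriv (deriv (testMode L b μ n)) r)
      = (lowerCoeff L n * testMode L b μ (n - 1) r + diagCoeff L b s κ μ n * testMode L b μ n r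
        + upperCoeff b s μ n * testMode L b μ (n + 1) r) / (1 + (r : ℂ) ^ 2) := by
  have hpow : ∀ (k : ℕ) (t : ℝ), HasDerivAt (fun t : ℝ => (t : ℂ) ^ k) (k * (t : ℂ) ^ (k - 1)) t :=
    fun k t => by simpa using (hasDerivAt_pow k (t : ℂ)).comp_ofReal
  have := radialOp_modeFactor_mul L b s κ μ (F := fun t => (t : ℂ) ^ n) (fun t _ => hpow n t)
    (fun t _ => (hpow (n - 1) t).const_mul (n : ℂ)) hr
  rw [heunOp_pow] at this
  refine this.trans ?_
  simp only [testMode]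
  ring

lemma one_add_ofReal_sq_ne_zero (r : ℝ) : 1 + (r : ℂ) ^ 2 ≠ 0 := by
  have : (1 + r ^ 2 : ℝ) ≠ 0 := by positivity
  exact_mod_cast this

/-! ### Functions with vanishing moments -/

/-- A continuous function on `[0, 1]` all of whose moments in the variable `heunCoord` vanish is zero,
by the Weierstrass approximation theorem. -/
lemma eqOn_zero_of_moments_real {g : ℝ → ℝ} (hg : ContinuousOn g (Icc 0 1))
    (hmom : ∀ n : ℕ, ∫ r in (0 : ℝ)..1, g r * heunCoord r ^ n = 0) :
    ∀ r ∈ Icc (0 : ℝ) 1, g r = 0 := by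
  have hz : Continuous heunCoord := contDiff_heunCoord.continuous
  have hint : ∀ p : ℝ → ℝ, Continuous p →
      IntervalIntegrable (fun r => g r * p (heunCoord r)) MeasureTheory.volume 0 1 := by
    intro p hp
    apply ContinuousOn.intervalIntegrable
    rw [uIcc_of_le zero_le_one]
    exact hg.mul (hp.comp hz).continuousOn
  have hpoly : ∀ p : Polynomial ℝ, ∫ r in (0 : ℝ)..1, g r * p.eval (heunCoord r) = 0 := by
    intro p
    induction p using Polynomial.induction_on' with
    | add p q hp hq =>
      simp only [Polynomial.eval_add, mul_add]
      rw [intervalIntegral.integral_add (hint _ p.continuous) (hint _ q.continuous), hp, hq,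
        add_zero]
    | monomial n a =>
      simp only [Polynomial.eval_monomial]
      have : ∀ r, g r * (a * heunCoord r ^ n) = a * (g r * heunCoord r ^ n) := fun r => by ring
      simp only [this, intervalIntegral.integral_const_mul, hmom, mul_zero]
  obtain ⟨K, hK⟩ := isCompact_Icc.exists_bound_of_continuousOn hg
  have hK0 : 0 ≤ K := (norm_nonneg _).trans (hK 0 (by simp))
  -- the inverse of `heunCoord` on `[0, 1]`
  set w : ℝ → ℝ := fun t => √(t / (2 - t)) with hw
  have hwmem : ∀ t ∈ Icc (0 : ℝ) 1, w t ∈ Icc (0 : ℝ) 1 := by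
    intro t ht
    have : 0 < 2 - t := by linarith [ht.2]
    refine ⟨Real.sqrt_nonneg _, Real.sqrt_le_one.2 ?_⟩
    rw [div_le_one this]
    linarith [ht.2]
  have hwz : ∀ r ∈ Icc (0 : ℝ) 1, w (heunCoord r) = r := by
    intro r hr
    have hq : (0 : ℝ) < 1 + r ^ 2 := by positivity
    have : heunCoord r / (2 - heunCoord r) = r ^ 2 := by
      have h2 : 2 - heunCoord r = 2 / (1 + r ^ 2) := by unfold heunCoord; field_simp; ring
      rw [h2]; unfold heunCoord; field_simp
    rw [hw]
    simp only [this]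
    exact Real.sqrt_sq hr.1
  have hwc : ContinuousOn (fun t => g (w t)) (Icc 0 1) := by
    refine hg.comp (ContinuousOn.sqrt (ContinuousOn.div ?_ ?_ ?_)) hwmem
    · fun_prop
    · fun_prop
    · intro t ht
      have := ht.2
      linarith
  have hsq : ∀ ε > 0, ∫ r in (0 : ℝ)..1, g r ^ 2 ≤ K * ε := by
    intro ε hε
    obtain ⟨p, hp⟩ := exists_polynomial_near_of_continuousOn 0 1 _ hwc ε hε
    have h1 : IntervalIntegrable (fun r => g r ^ 2) MeasureTheory.volume 0 1 := by
      apply ContinuousOn.intervalIntegrable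
      rw [uIcc_of_le zero_le_one]
      exact hg.pow 2
    have h2 := intervalIntegral.integral_sub h1 (hint _ p.continuous)
    rw [hpoly, sub_zero] at h2
    rw [← h2]
    have h3 := intervalIntegral.norm_integral_le_of_norm_le_const (a := (0 : ℝ)) (b := 1)
      (C := K * ε) (f := fun r => g r ^ 2 - g r * p.eval (heunCoord r)) ?_
    · rw [sub_zero, abs_one, mul_one] at h3
      exact (le_abs_self _).trans h3
    · intro r hr
      rw [uIoc_of_le zero_le_one] at hr
      have hr' := Ioc_subset_Icc_self hr
      have h4 := (hp _ (heunCoord_mem_Icc hr')).le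
      rw [hwz r hr', abs_sub_comm] at h4
      have : g r ^ 2 - g r * p.eval (heunCoord r) = g r * (g r - p.eval (heunCoord r)) := by ring
      rw [this, norm_mul]
      exact mul_le_mul (hK r hr') h4 (norm_nonneg _) hK0
  have hle : ∫ r in (0 : ℝ)..1, g r ^ 2 ≤ 0 := by
    refine le_of_forall_pos_le_add fun ε hε => ?_
    have := hsq (ε / (K + 1)) (by positivity)
    have h2 : K * (ε / (K + 1)) ≤ ε := by
      rw [← mul_div_assoc, div_le_iff₀ (by positivity)]
      nlinarith
    linarith
  by_contra! hne
  obtain ⟨c, hc, hgc⟩ := hne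
  have hgc2 : 0 < g c ^ 2 := by positivity
  have : 0 < ∫ r in (0 : ℝ)..1, g r ^ 2 := intervalIntegral.integral_pos zero_lt_one
    (f := fun r => g r ^ 2) (hg.pow 2) (fun r _ => sq_nonneg (g r)) ⟨c, hc, hgc2⟩
  linarith

lemma eqOn_zero_of_moments {G : ℝ → ℂ} (hG : ContinuousOn G (Icc 0 1))
    (hmom : ∀ n : ℕ, ∫ r in (0 : ℝ)..1, G r * (heunCoord r : ℂ) ^ n = 0) :
    ∀ r ∈ Icc (0 : ℝ) 1, G r = 0 := by
  have hint : ∀ n : ℕ, IntervalIntegrable (fun r => G r * (heunCoord r : ℂ) ^ n)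
      MeasureTheory.volume 0 1 := by
    intro n
    apply ContinuousOn.intervalIntegrable
    rw [uIcc_of_le zero_le_one]
    have := contDiff_heunCoord.continuous
    exact hG.mul (by fun_prop)
  have hre := eqOn_zero_of_moments_real (Complex.continuous_re.comp_continuousOn hG) (fun n => by
    have := ContinuousLinearMap.intervalIntegral_comp_comm (𝕜 := ℝ) Complex.reCLM (hint n)
    rw [hmom, map_zero] at this
    refine Eq.trans ?_ this
    refine intervalIntegral.integral_congr fun r _ => ?_
    simp [← Complex.ofReal_pow])
  have him := eqOn_zero_of_moments_real (Complex.continuous_im.comp_continuousOn hG) (fun n => by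
    have := ContinuousLinearMap.intervalIntegral_comp_comm (𝕜 := ℝ) Complex.imCLM (hint n)
    rw [hmom, map_zero] at this
    refine Eq.trans ?_ this
    refine intervalIntegral.integral_congr fun r _ => ?_
    simp [← Complex.ofReal_pow])
  exact fun r hr => Complex.ext (hre r hr) (him r hr)

/-! ### Smooth functions on `[0, 1]` and their Wronskians -/

lemma deriv_eq_derivWithin_Icc {f : ℝ → ℂ} {r : ℝ} (hr : r ∈ Ioo (0 : ℝ) 1) :
    deriv f r = derivWithin f (Icc 0 1) r :=
  (derivWithin_of_mem_nhds (Icc_mem_nhds hr.1 hr.2)).symm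

lemma hasDerivAt_of_contDiffOn {f : ℝ → ℂ} (hf : ContDiffOn ℝ ∞ f (Icc 0 1)) {r : ℝ}
    (hr : r ∈ Ioo (0 : ℝ) 1) : HasDerivAt f (derivWithin f (Icc 0 1) r) r :=
  ((hf.differentiableOn (by simp)) r (Ioo_subset_Icc_self hr)).hasDerivWithinAt.hasDerivAt
    (Icc_mem_nhds hr.1 hr.2)

lemma contDiffOn_derivWithin_Icc {f : ℝ → ℂ} (hf : ContDiffOn ℝ ∞ f (Icc 0 1)) :
    ContDiffOn ℝ ∞ (derivWithin f (Icc 0 1)) (Icc 0 1) :=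
  hf.derivWithin (uniqueDiffOn_Icc zero_lt_one) (by simp)

lemma deriv_deriv_eq_derivWithin {f : ℝ → ℂ} {r : ℝ} (hr : r ∈ Ioo (0 : ℝ) 1) :
    deriv (deriv f) r = derivWithin (derivWithin f (Icc 0 1)) (Icc 0 1) r := by
  rw [← deriv_eq_derivWithin_Icc hr]
  refine Filter.EventuallyEq.deriv_eq ?_
  filter_upwards [isOpen_Ioo.mem_nhds hr] with r hr using deriv_eq_derivWithin_Icc hr

lemma eqOn_Icc_of_eqOn_Ioo {f g : ℝ → ℂ} (hf : ContinuousOn f (Icc 0 1))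
    (hg : ContinuousOn g (Icc 0 1)) (h : EqOn f g (Ioo 0 1)) : EqOn f g (Icc 0 1) :=
  h.of_subset_closure hf hg Ioo_subset_Icc_self (by rw [closure_Ioo zero_ne_one])

/-- The Wronskian of `φ` and `v`, weighted by `r ^ 2`; the one-sided derivative of `φ` makes it smooth
up to the endpoints of `[0, 1]`. -/
noncomputable def radialWronskian (φ v : ℝ → ℂ) (r : ℝ) : ℂ :=
  (r : ℂ) ^ 2 * (derivWithin φ (Icc 0 1) r * v r - φ r * deriv v r)

lemma contDiffOn_radialWronskian {φ v : ℝ → ℂ} (hφ : ContDiffOn ℝ ∞ φ (Icc 0 1))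
    (hv : ContDiff ℝ ∞ v) : ContDiffOn ℝ ∞ (radialWronskian φ v) (Icc 0 1) := by
  have h1 : ContDiff ℝ ∞ (fun r : ℝ => (r : ℂ)) := Complex.ofRealCLM.contDiff
  have h2 : ContDiff ℝ ∞ (deriv v) := (contDiff_infty_iff_deriv.1 hv).2
  exact (h1.pow 2).contDiffOn.mul
    (((contDiffOn_derivWithin_Icc hφ).mul hv.contDiffOn).sub (hφ.mul h2.contDiffOn))

lemma radialWronskian_zero (φ v : ℝ → ℂ) : radialWronskian φ v 0 = 0 := by
  simp [radialWronskian]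

/-- Lagrange's identity for the radial operator, which is formally self-adjoint with respect to the
weight `r ^ 2 * (1 - r ^ 2) ^ (μ - 1)`. -/
lemma radialWronskian_divergence {φ v : ℝ → ℂ} (hφ : ContDiffOn ℝ ∞ φ (Icc 0 1))
    (hv : ContDiff ℝ ∞ v) {U : ℝ → ℝ} {μ : ℂ} {r : ℝ} (hr : r ∈ Ioo (0 : ℝ) 1)
    (heq : radialOp (U r) μ r (φ r) (deriv φ r) (deriv (deriv φ) r) = 0) :
    (1 - (r : ℂ) ^ 2) * derivWithin (radialWronskian φ v) (Icc 0 1) r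
        - 2 * μ * r * radialWronskian φ v r
      = -((r : ℂ) ^ 2 * φ r * radialOp (U r) μ r (v r) (deriv v r) (deriv (deriv v) r)) := by
  have hr0 : (r : ℂ) ≠ 0 := by exact_mod_cast hr.1.ne'
  have h2 : ContDiff ℝ ∞ (deriv v) := (contDiff_infty_iff_deriv.1 hv).2
  have hid : HasDerivAt (fun r : ℝ => (r : ℂ)) 1 r := Complex.ofRealCLM.hasDerivAt
  have hv1 : HasDerivAt v (deriv v r) r := (hv.differentiable (by simp) r).hasDerivAt
  have hv2 : HasDerivAt (deriv v) (deriv (deriv v) r) r := (h2.differentiable (by simp) r).hasDerivAt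
  have hφ1 := hasDerivAt_of_contDiffOn hφ hr
  have hφ2 := hasDerivAt_of_contDiffOn (contDiffOn_derivWithin_Icc hφ) hr
  have hW : HasDerivAt (radialWronskian φ v)
      (2 * r * (derivWithin φ (Icc 0 1) r * v r - φ r * deriv v r)
        + (r : ℂ) ^ 2 * (derivWithin (derivWithin φ (Icc 0 1)) (Icc 0 1) r * v r
          - φ r * deriv (deriv v) r)) r := by
    refine ((hid.pow 2).mul ((hφ2.mul hv1).sub (hφ1.mul hv2))).congr_deriv ?_
    simp only [Pi.mul_apply, Pi.sub_apply, Pi.pow_apply, Nat.cast_ofNat]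
    ring
  rw [← deriv_eq_derivWithin_Icc hr, hW.deriv]
  rw [deriv_eq_derivWithin_Icc hr, deriv_deriv_eq_derivWithin hr] at heq
  unfold radialOp at heq ⊢
  unfold radialWronskian
  have e : (r : ℂ) ^ 2 * (2 / (r : ℂ)) = 2 * r := by field_simp
  linear_combination (r : ℂ) ^ 2 * v r * heq
    - (derivWithin φ (Icc 0 1) r * v r - φ r * deriv v r) * e

lemma one_sub_heunCoord (r : ℝ) : 1 - heunCoord r = (1 - r ^ 2) / (1 + r ^ 2) := by
  unfold heunCoord
  have : (1 + r ^ 2 : ℝ) ≠ 0 := by positivity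
  field_simp
  ring

/-! ### Uniqueness for the radial equation, `μ ≠ 0` -/

/-- The product of `φ` with the `n`-th test function and the weight `r ^ 2 / (1 + r ^ 2)`. The
`n`-th moment of a solution with growth rate `μ ≠ 0` is the finite part of the integral of this kernel
against `(1 - r ^ 2) ^ (μ - 1)`; for the growth rate `0` it is the plain integral of the kernel with
parameter `2`. -/
noncomputable def momentKernel (φ : ℝ → ℂ) (L b : ℕ) (μ : ℂ) (n : ℕ) (r : ℝ) : ℂ :=
  (r : ℂ) ^ 2 / (1 + (r : ℂ) ^ 2) * φ r * testMode L b μ n r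

lemma momentKernel_eq (φ : ℝ → ℂ) (L b : ℕ) (μ : ℂ) (n : ℕ) (r : ℝ) :
    momentKernel φ L b μ n r = momentKernel φ L b μ 0 r * (heunCoord r : ℂ) ^ n := by
  simp [momentKernel, testMode, mul_assoc]

lemma contDiffOn_momentKernel {φ : ℝ → ℂ} (hφ : ContDiffOn ℝ ∞ φ (Icc 0 1)) (L b : ℕ) (μ : ℂ)
    (n : ℕ) : ContDiffOn ℝ ∞ (momentKernel φ L b μ n) (Icc 0 1) := by
  have h1 : ContDiff ℝ ∞ (fun r : ℝ => (r : ℂ)) := Complex.ofRealCLM.contDiff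
  have h2 : ContDiff ℝ ∞ (fun r : ℝ => (r : ℂ) ^ 2 / (1 + (r : ℂ) ^ 2)) := by
    simp only [div_eq_mul_inv]
    exact (h1.pow 2).mul ((contDiff_const.add (h1.pow 2)).inv one_add_ofReal_sq_ne_zero)
  exact (h2.contDiffOn.mul hφ).mul (contDiff_testMode L b μ n).contDiffOn

lemma eqOn_zero_of_momentKernel {φ : ℝ → ℂ} (hφ : ContDiffOn ℝ ∞ φ (Icc 0 1)) {L b : ℕ} {μ : ℂ}
    (h : ∀ r ∈ Ioo (0 : ℝ) 1, momentKernel φ L b μ 0 r = 0) : ∀ r ∈ Icc (0 : ℝ) 1, φ r = 0 := by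
  refine eqOn_Icc_of_eqOn_Ioo hφ.continuousOn continuousOn_const fun r hr => ?_
  have h0 := h r hr
  have hr0 : (r : ℂ) ≠ 0 := by exact_mod_cast hr.1.ne'
  have hq := one_add_ofReal_sq_ne_zero r
  have := modeFactor_ne_zero L b μ hr.1.ne'
  simpa [momentKernel, testMode, hr0, hq, this] using h0

/-- Uniqueness for the radial equation with `μ ≠ 0`: the finite-part moments of `φ` grow at most
linearly and satisfy the transposed recurrence, hence vanish. -/
lemma radial_unique_of_ne_zero {L b : ℕ} {s κ : ℝ} (hrig : RecurrenceRigid L b s κ) {μ : ℂ}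
    (hμ : 0 ≤ μ.re) (hμ0 : μ ≠ 0) {φ : ℝ → ℂ} (hφ : ContDiffOn ℝ ∞ φ (Icc 0 1))
    (heq : ∀ r ∈ Ioo (0 : ℝ) 1,
      radialOp (rationalPotential L b s κ r) μ r (φ r) (deriv φ r) (deriv (deriv φ) r) = 0) :
    ∀ r ∈ Icc (0 : ℝ) 1, φ r = 0 := by
  set h := momentKernel φ L b μ with hh
  have hsm : ∀ n, ContDiffOn ℝ 1 (h n) (Icc 0 1) := fun n =>
    (contDiffOn_momentKernel hφ L b μ n).of_le (by exact_mod_cast le_top)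
  have hcm : ∀ (c : ℂ) n, ContDiffOn ℝ 1 (fun r => c * h n r) (Icc 0 1) := fun c n =>
    contDiffOn_const.mul (hsm n)
  have hrec : ∀ n, lowerCoeff L n * finitePart μ (h (n - 1))
      + diagCoeff L b s κ μ n * finitePart μ (h n)
      + upperCoeff b s μ n * finitePart μ (h (n + 1)) = 0 := by
    intro n
    have hW := contDiffOn_radialWronskian hφ (contDiff_testMode L b μ n)
    have hEq : EqOn (fun r : ℝ => (1 - (r : ℂ) ^ 2) *
          derivWithin (radialWronskian φ (testMode L b μ n)) (Icc 0 1) r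
          - 2 * μ * r * radialWronskian φ (testMode L b μ n) r)
        (fun r => -1 * (lowerCoeff L n * h (n - 1) r + diagCoeff L b s κ μ n * h n r
          + upperCoeff b s μ n * h (n + 1) r)) (Icc 0 1) := by
      refine eqOn_Icc_of_eqOn_Ioo ?_ ?_ ?_
      · have h1 := (contDiffOn_derivWithin_Icc hW).continuousOn
        have h2 := hW.continuousOn
        fun_prop
      · have h1 := fun n => (hsm n).continuousOn
        fun_prop
      · intro r hr
        simp only
        rw [radialWronskian_divergence hφ (contDiff_testMode L b μ n) hr
          (U := rationalPotential L b s κ) (heq r hr), radialOp_testMode L b s κ μ n hr]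
        simp only [hh, momentKernel]
        ring
    have hdiv := finitePart_divergence hμ hμ0 (contDiffOn_infty.1 hW 2)
    rw [radialWronskian_zero, finitePart_congr μ hEq, finitePart_const_mul,
      finitePart_add hμ ((hcm _ _).add (hcm _ _)) (hcm _ _), finitePart_add hμ (hcm _ _) (hcm _ _),
      finitePart_const_mul, finitePart_const_mul, finitePart_const_mul] at hdiv
    linear_combination -hdiv
  obtain ⟨K, hK0, hK⟩ := exists_norm_sub_one_le (hsm 0)
  have hz1 : heunCoord 1 = 1 := by norm_num [heunCoord]
  have hval : ∀ n, h n 1 = h 0 1 := fun n => by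
    rw [hh, momentKernel_eq, hz1]; simp
  have hgrow : ∀ n : ℕ, ‖finitePart μ (h n)‖
      ≤ (K + 3 * ‖h 0 1‖ + ‖h 0 1 / (2 * μ)‖) * (n + 1) := by
    intro n
    have hKn : ∀ r ∈ Icc (0 : ℝ) 1, ‖h n r - h n 1‖ ≤ (K + 2 * n * ‖h 0 1‖) * (1 - r) := by
      intro r hr
      obtain ⟨hz0, hz1'⟩ := heunCoord_mem_Icc hr
      have hbern : 1 - heunCoord r ^ n ≤ n * (1 - heunCoord r) := by
        have := one_add_mul_le_pow (a := heunCoord r - 1) (by linarith) n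
        rw [add_sub_cancel] at this
        linarith
      have hlip : 1 - heunCoord r ≤ 2 * (1 - r) := by
        rw [one_sub_heunCoord, div_le_iff₀ (by positivity)]
        nlinarith [hr.1, hr.2, sq_nonneg r, mul_nonneg (sub_nonneg.2 hr.2) (sq_nonneg r)]
      have hpow0 : 0 ≤ heunCoord r ^ n := by positivity
      have hpow1 : heunCoord r ^ n ≤ 1 := pow_le_one₀ hz0 hz1'
      have e : h n r - h n 1 = (h 0 r - h 0 1) * ((heunCoord r ^ n : ℝ) : ℂ)
          - h 0 1 * ((1 - heunCoord r ^ n : ℝ) : ℂ) := by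
        rw [hval, hh, momentKernel_eq]
        push_cast
        ring
      rw [e]
      refine (norm_sub_le _ _).trans ?_
      rw [norm_mul, norm_mul, Complex.norm_real, Complex.norm_real, Real.norm_of_nonneg hpow0,
        Real.norm_of_nonneg (by linarith)]
      have h1 : ‖h 0 r - h 0 1‖ * heunCoord r ^ n ≤ K * (1 - r) * 1 :=
        mul_le_mul (hK r hr) hpow1 hpow0 (mul_nonneg hK0 (by linarith [hr.2]))
      have h2 : 1 - heunCoord r ^ n ≤ n * (2 * (1 - r)) :=
        hbern.trans (by gcongr)
      have h3 := mul_le_mul_of_nonneg_left h2 (norm_nonneg (h 0 1))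
      linarith
    have := norm_finitePart_le hμ hKn
    rw [hval n] at this
    have h1 : 0 ≤ (n : ℝ) * K := by positivity
    have h2 : 0 ≤ (n : ℝ) * ‖h 0 1 / (2 * μ)‖ := by positivity
    have h3 : 0 ≤ (n : ℝ) * ‖h 0 1‖ := by positivity
    nlinarith [norm_nonneg (h 0 1)]
  have hM := hrig μ hμ (fun n => finitePart μ (h n)) _ hgrow hrec
  -- the second difference of the moments carries the factor `(1 - heunCoord r) ^ 2`, so that its
  -- kernel is continuous up to `r = 1`
  have hμ1 : 0 < (μ + 1).re := by simp; linarith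
  have hw : Continuous fun r : ℝ => ((1 - r ^ 2 : ℝ) : ℂ) ^ (μ + 1) :=
    (Complex.continuous_ofReal_cpow_const hμ1).comp (by fun_prop)
  have hmom : ∀ n : ℕ, ∫ r in (0 : ℝ)..1, (h 0 r * (1 / (1 + (r : ℂ) ^ 2) ^ 2)
      * ((1 - r ^ 2 : ℝ) : ℂ) ^ (μ + 1)) * (heunCoord r : ℂ) ^ n = 0 := by
    intro n
    have h1 : finitePart μ (fun r => h n r + (-2 * h (n + 1) r + 1 * h (n + 2) r)) = 0 := by
      rw [finitePart_add hμ (hsm n) ((hcm _ _).add (hcm _ _)),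
        finitePart_add hμ (hcm _ _) (hcm _ _), finitePart_const_mul, finitePart_const_mul]
      simp only [hM]
      simp
    rw [finitePart_of_eq_zero] at h1
    · rw [← h1]
      refine intervalIntegral.integral_congr_Ioo_of_le zero_le_one fun r hr => ?_
      have hrp : 0 < 1 - r ^ 2 := by nlinarith [hr.1, hr.2]
      have hrp' : ((1 - r ^ 2 : ℝ) : ℂ) ≠ 0 := by exact_mod_cast hrp.ne'
      have hq := one_add_ofReal_sq_ne_zero r
      have hz : (1 - (heunCoord r : ℂ)) = (1 - (r : ℂ) ^ 2) / (1 + (r : ℂ) ^ 2) := by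
        exact_mod_cast one_sub_heunCoord r
      have e : h n r + (-2 * h (n + 1) r + 1 * h (n + 2) r)
          = h 0 r * (1 - (heunCoord r : ℂ)) ^ 2 * (heunCoord r : ℂ) ^ n := by
        rw [hh, momentKernel_eq φ L b μ n, momentKernel_eq φ L b μ (n + 1),
          momentKernel_eq φ L b μ (n + 2)]
        ring
      have e2 : ((1 - r ^ 2 : ℝ) : ℂ) ^ (μ + 1)
          = ((1 - r ^ 2 : ℝ) : ℂ) ^ (μ - 1) * (1 - (r : ℂ) ^ 2) ^ 2 := by
        rw [show μ + 1 = μ - 1 + (2 : ℕ) by push_cast; ring, Complex.cpow_add _ _ hrp',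
          Complex.cpow_natCast]
        push_cast
        ring
      rw [e, e2, hz]
      field_simp
    · rw [hval n, hval (n + 1), hval (n + 2)]
      ring
  have hG := eqOn_zero_of_moments (ContinuousOn.mul (ContinuousOn.mul (hsm 0).continuousOn (by
    refine ContinuousOn.div (by fun_prop) (by fun_prop) fun r _ => ?_
    have hq : ((1 + r ^ 2) ^ 2 : ℝ) ≠ 0 := by positivity
    exact_mod_cast hq)) hw.continuousOn) hmom
  refine eqOn_zero_of_momentKernel hφ (L := L) (b := b) (μ := μ) fun r hr => ?_
  have h1 := hG r (Ioo_subset_Icc_self hr)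
  have hrp : 0 < 1 - r ^ 2 := by nlinarith [hr.1, hr.2]
  have hrp' : ((1 - r ^ 2 : ℝ) : ℂ) ≠ 0 := by exact_mod_cast hrp.ne'
  have hq := one_add_ofReal_sq_ne_zero r
  have hcp : ((1 - r ^ 2 : ℝ) : ℂ) ^ (μ + 1) ≠ 0 := by
    rw [Complex.cpow_ne_zero_iff]; exact Or.inl hrp'
  exact (mul_eq_zero.1 ((mul_eq_zero.1 h1).resolve_right hcp)).resolve_right
    (div_ne_zero one_ne_zero (pow_ne_zero 2 hq))

/-! ### Uniqueness for the radial equation, `μ = 0` -/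

/-- At `r = 1` and `μ = 0` the radial equation degenerates to `κ * φ 1 = 0`. -/
lemma apply_one_eq_zero_of_radialOp_zero {L b : ℕ} {s κ : ℝ} (hκ : κ ≠ 0) {φ : ℝ → ℂ}
    (hφ : ContDiffOn ℝ ∞ φ (Icc 0 1))
    (heq : ∀ r ∈ Ioo (0 : ℝ) 1,
      radialOp (rationalPotential L b s κ r) 0 r (φ r) (deriv φ r) (deriv (deriv φ) r) = 0) :
    φ 1 = 0 := by
  set φ₁ := derivWithin φ (Icc 0 1) with hφ₁
  set φ₂ := derivWithin φ₁ (Icc 0 1) with hφ₂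
  have h1 := contDiffOn_derivWithin_Icc hφ
  have h2 := (contDiffOn_derivWithin_Icc h1).continuousOn
  have h1 := h1.continuousOn
  have h0 := hφ.continuousOn
  rw [← hφ₁] at h1 h2
  rw [← hφ₂] at h2
  have hE : EqOn (fun r : ℝ => (1 - (r : ℂ) ^ 2) * (1 + (r : ℂ) ^ 2) ^ 2
        * ((r : ℂ) ^ 2 * φ₂ r + 2 * r * φ₁ r))
      (fun r : ℝ => ((r : ℂ) ^ 2 * (1 + (r : ℂ) ^ 2) ^ 2) * rationalPotential L b s κ r * φ r)
      (Ioo 0 1) := by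
    intro r hr
    have hr0 : (r : ℂ) ≠ 0 := by exact_mod_cast hr.1.ne'
    have h := heq r hr
    rw [deriv_eq_derivWithin_Icc hr, deriv_deriv_eq_derivWithin hr] at h
    unfold radialOp at h
    have e : (r : ℂ) ^ 2 * (2 / (r : ℂ)) = 2 * r := by field_simp
    linear_combination ((r : ℂ) ^ 2 * (1 + (r : ℂ) ^ 2) ^ 2) * h
      - (1 + (r : ℂ) ^ 2) ^ 2 * φ₁ r * e
  have hU : ∀ r ∈ Ioo (0 : ℝ) 1, ((r : ℂ) ^ 2 * (1 + (r : ℂ) ^ 2) ^ 2) * rationalPotential L b s κ r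
      = -((L - b) * (L - b + 1)) * r ^ 6 + (2 * κ + s - 1 - L * (L + 1)) * r ^ 4
        + (2 * κ - s + 1 + (L - b) * (L - b + 1)) * r ^ 2 + L * (L + 1) := by
    intro r hr
    have hr0 : (r : ℂ) ≠ 0 := by exact_mod_cast hr.1.ne'
    have hq := one_add_ofReal_sq_ne_zero r
    unfold rationalPotential
    push_cast
    field_simp
  have hE' := eqOn_Icc_of_eqOn_Ioo (f := fun r : ℝ => (1 - (r : ℂ) ^ 2) * (1 + (r : ℂ) ^ 2) ^ 2
        * ((r : ℂ) ^ 2 * φ₂ r + 2 * r * φ₁ r))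
      (g := fun r : ℝ => (-((L - b) * (L - b + 1)) * (r : ℂ) ^ 6
        + (2 * κ + s - 1 - L * (L + 1)) * (r : ℂ) ^ 4
        + (2 * κ - s + 1 + (L - b) * (L - b + 1)) * (r : ℂ) ^ 2 + L * (L + 1)) * φ r)
      (by fun_prop) (by fun_prop) (fun r hr => by
        simp only
        rw [← hU r hr]
        exact hE hr)
  have h := hE' (right_mem_Icc.2 zero_le_one)
  simp at h
  have hne : (4 * κ : ℂ) ≠ 0 := by
    have : 4 * κ ≠ 0 := by simpa using hκ
    exact_mod_cast this
  have : (4 * κ : ℂ) * φ 1 = 0 := by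
    rcases h with h | h
    · rw [show (4 * κ : ℂ) = 0 by linear_combination h, zero_mul]
    · rw [h, mul_zero]
  exact (mul_eq_zero.1 this).resolve_left hne

/-- Multiplication by `1 - r ^ 2` intertwines the radial operators with growth rates `0` and `2`; the
second and third arguments on the left are the derivatives of `(1 - r ^ 2) * v`. -/
lemma radialOp_zero_one_sub_sq_mul (U : ℝ) {r : ℝ} (hr : r ≠ 0) (v v' v'' : ℂ) :
    radialOp U 0 r ((1 - (r : ℂ) ^ 2) * v) (-(2 * r) * v + (1 - (r : ℂ) ^ 2) * v')
      (-2 * v - 4 * r * v' + (1 - (r : ℂ) ^ 2) * v'')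
      = (1 - (r : ℂ) ^ 2) * radialOp U 2 r v v' v'' := by
  have hr' : (r : ℂ) ≠ 0 := by exact_mod_cast hr
  unfold radialOp
  field_simp
  ring

/-- Uniqueness for the radial equation with `μ = 0`: since `φ 1 = 0`, the test functions for the
growth rate `2`, multiplied by `1 - r ^ 2`, produce no boundary term at `r = 1`, and the resulting
moments satisfy the recurrence with `μ = 2`. -/
lemma radial_unique_of_eq_zero {L b : ℕ} {s κ : ℝ} (hrig : RecurrenceRigid L b s κ) (hκ : κ ≠ 0)
    {φ : ℝ → ℂ} (hφ : ContDiffOn ℝ ∞ φ (Icc 0 1))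
    (heq : ∀ r ∈ Ioo (0 : ℝ) 1,
      radialOp (rationalPotential L b s κ r) 0 r (φ r) (deriv φ r) (deriv (deriv φ) r) = 0) :
    ∀ r ∈ Icc (0 : ℝ) 1, φ r = 0 := by
  have hφ1 := apply_one_eq_zero_of_radialOp_zero hκ hφ heq
  set h := momentKernel φ L b 2 with hh
  have hcont : ∀ n, ContinuousOn (h n) (Icc 0 1) := fun n =>
    (contDiffOn_momentKernel hφ L b 2 n).continuousOn
  have hint : ∀ (c : ℂ) n, IntervalIntegrable (fun r => c * h n r) MeasureTheory.volume 0 1 := by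
    intro c n
    apply ContinuousOn.intervalIntegrable
    rw [uIcc_of_le zero_le_one]
    exact continuousOn_const.mul (hcont n)
  have hrec : ∀ n, lowerCoeff L n * (∫ r in (0 : ℝ)..1, h (n - 1) r)
      + diagCoeff L b s κ 2 n * (∫ r in (0 : ℝ)..1, h n r)
      + upperCoeff b s 2 n * (∫ r in (0 : ℝ)..1, h (n + 1) r) = 0 := by
    intro n
    have hsq : ContDiff ℝ ∞ (fun r : ℝ => 1 - (r : ℂ) ^ 2) :=
      contDiff_const.sub (Complex.ofRealCLM.contDiff.pow 2)
    set v : ℝ → ℂ := fun r => (1 - (r : ℂ) ^ 2) * testMode L b 2 n r with hv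
    have hvsm : ContDiff ℝ ∞ v := hsq.mul (contDiff_testMode L b 2 n)
    have hsq' : ∀ r : ℝ, HasDerivAt (fun r : ℝ => 1 - (r : ℂ) ^ 2) (-(2 * (r : ℂ))) r := by
      intro r
      have hid : HasDerivAt (fun r : ℝ => (r : ℂ)) 1 r := Complex.ofRealCLM.hasDerivAt
      simpa using (hid.pow 2).const_sub (1 : ℂ)
    have htm := contDiff_testMode L b 2 n
    have htm' := (contDiff_infty_iff_deriv.1 htm).2
    have hv1 : ∀ r, HasDerivAt v (-(2 * r) * testMode L b 2 n r
        + (1 - (r : ℂ) ^ 2) * deriv (testMode L b 2 n) r) r := fun r =>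
      (hsq' r).mul (htm.differentiable (by simp) r).hasDerivAt
    have hv1' : deriv v = fun r : ℝ => -(2 * (r : ℂ)) * testMode L b 2 n r
        + (1 - (r : ℂ) ^ 2) * deriv (testMode L b 2 n) r := funext fun r => (hv1 r).deriv
    have hv2 : ∀ r, deriv (deriv v) r = -2 * testMode L b 2 n r
        - 4 * r * deriv (testMode L b 2 n) r
        + (1 - (r : ℂ) ^ 2) * deriv (deriv (testMode L b 2 n)) r := by
      intro r
      have hid : HasDerivAt (fun r : ℝ => -(2 * (r : ℂ))) (-2) r := by
        refine ((Complex.ofRealCLM.hasDerivAt (x := r)).const_mul (2 : ℂ)).neg.congr_deriv ?_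
        simp
      rw [hv1']
      refine HasDerivAt.deriv (((hid.mul (htm.differentiable (by simp) r).hasDerivAt).add
        ((hsq' r).mul (htm'.differentiable (by simp) r).hasDerivAt)).congr_deriv ?_)
      ring
    have hW := contDiffOn_radialWronskian hφ hvsm
    have hder : ∀ r ∈ Ioo (0 : ℝ) 1, HasDerivAt (radialWronskian φ v)
        (-1 * (lowerCoeff L n * h (n - 1) r + diagCoeff L b s κ 2 n * h n r
          + upperCoeff b s 2 n * h (n + 1) r)) r := by
      intro r hr
      refine (hasDerivAt_of_contDiffOn hW hr).congr_deriv ?_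
      have hrp : 0 < 1 - r ^ 2 := by nlinarith [hr.1, hr.2]
      have hrp' : (1 - (r : ℂ) ^ 2) ≠ 0 := by exact_mod_cast hrp.ne'
      have := radialWronskian_divergence hφ hvsm hr (U := rationalPotential L b s κ) (heq r hr)
      rw [hv2, (hv1 r).deriv, hv, radialOp_zero_one_sub_sq_mul _ hr.1.ne',
        radialOp_testMode L b s κ 2 n hr] at this
      refine mul_left_cancel₀ hrp' ?_
      rw [← hv] at this
      simp only [hh, momentKernel]
      linear_combination this
    have hint3 := ((hint (lowerCoeff L n) (n - 1)).add (hint (diagCoeff L b s κ 2 n) n)).add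
      (hint (upperCoeff b s 2 n) (n + 1))
    have hftc := intervalIntegral.integral_eq_sub_of_hasDerivAt_of_le zero_le_one
      hW.continuousOn hder (hint3.const_mul (-1))
    have hW1 : radialWronskian φ v 1 = 0 := by simp [radialWronskian, hφ1, hv]
    rw [hW1, radialWronskian_zero, intervalIntegral.integral_const_mul,
      intervalIntegral.integral_add ((hint _ _).add (hint _ _)) (hint _ _),
      intervalIntegral.integral_add (hint _ _) (hint _ _), intervalIntegral.integral_const_mul,
      intervalIntegral.integral_const_mul, intervalIntegral.integral_const_mul] at hftc
    linear_combination -hftc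
  obtain ⟨K, hK⟩ := isCompact_Icc.exists_bound_of_continuousOn (hcont 0)
  have hK0 : 0 ≤ K := (norm_nonneg _).trans (hK 0 (by simp))
  have hgrow : ∀ n : ℕ, ‖∫ r in (0 : ℝ)..1, h n r‖ ≤ K * (n + 1) := by
    intro n
    have := intervalIntegral.norm_integral_le_of_norm_le_const (a := (0 : ℝ)) (b := 1)
      (C := K) (f := h n) ?_
    · rw [sub_zero, abs_one, mul_one] at this
      have h1 : 0 ≤ K * n := by positivity
      linarith
    · intro r hr
      rw [uIoc_of_le zero_le_one] at hr
      have hr' := Ioc_subset_Icc_self hr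
      obtain ⟨hz0, hz1⟩ := heunCoord_mem_Icc hr'
      rw [hh, momentKernel_eq, norm_mul, norm_pow, Complex.norm_real, Real.norm_of_nonneg hz0]
      calc _ ≤ K * 1 := mul_le_mul (hK r hr') (pow_le_one₀ hz0 hz1) (by positivity) hK0
        _ = K := mul_one K
  have hM := hrig 2 (by simp) (fun n => ∫ r in (0 : ℝ)..1, h n r) K hgrow hrec
  have hG := eqOn_zero_of_moments (hcont 0) fun n => by
    simp only [← hM n]
    exact intervalIntegral.integral_congr fun r _ => (momentKernel_eq φ L b 2 n r).symm
  exact eqOn_zero_of_momentKernel hφ fun r hr => hG r (Ioo_subset_Icc_self hr)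

/-! ### Uniqueness for the radial and the Heun form -/

theorem radial_unique {L b : ℕ} {s κ : ℝ} (hrig : RecurrenceRigid L b s κ) (hκ : κ ≠ 0) {μ : ℂ}
    (hμ : 0 ≤ μ.re) {φ : ℝ → ℂ} (hφ : ContDiffOn ℝ ∞ φ (Icc 0 1))
    (heq : ∀ r ∈ Ioo (0 : ℝ) 1,
      radialOp (rationalPotential L b s κ r) μ r (φ r) (deriv φ r) (deriv (deriv φ) r) = 0) :
    ∀ r ∈ Icc (0 : ℝ) 1, φ r = 0 := by
  rcases eq_or_ne μ 0 with rfl | hμ0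
  · exact radial_unique_of_eq_zero hrig hκ hφ heq
  · exact radial_unique_of_ne_zero hrig hμ hμ0 hφ heq

/-- Uniqueness for the Heun form: `modeFactor * ψ ∘ heunCoord` is a smooth solution of the radial
form, so `ψ` vanishes on `(0, 1)`, and then on `Ω` by the identity theorem. -/
theorem heun_unique {L b : ℕ} {s κ : ℝ} (hrig : RecurrenceRigid L b s κ) (hκ : κ ≠ 0) {μ : ℂ}
    (hμ : 0 ≤ μ.re) {Ω : Set ℂ} {ψ : ℂ → ℂ} (hΩ : IsOpen Ω) (hΩc : IsConnected Ω)
    (hΩ01 : ∀ x ∈ Ioo (0 : ℝ) 1, (x : ℂ) ∈ Ω) (hψ : DifferentiableOn ℂ ψ Ω)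
    (heq : ∀ z ∈ Ω, heunOp L b s κ μ z (ψ z) (deriv ψ z) (deriv (deriv ψ) z) = 0)
    (hsm : ContDiffOn ℝ ∞ (fun x : ℝ => ψ (x : ℂ)) (Icc 0 1)) :
    (∀ z ∈ Ω, ψ z = 0) ∧ ψ 0 = 0 ∧ ψ 1 = 0 := by
  set φ : ℝ → ℂ := fun r => modeFactor L b μ r * ψ (heunCoord r : ℂ) with hφdef
  have hφ : ContDiffOn ℝ ∞ φ (Icc 0 1) :=
    (contDiff_modeFactor L b μ).contDiffOn.mul
      (hsm.comp contDiff_heunCoord.contDiffOn fun _ hr => heunCoord_mem_Icc hr)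
  have hF : ∀ t ∈ Ioo (0 : ℝ) 1, HasDerivAt (fun t : ℝ => ψ (t : ℂ)) (deriv ψ (t : ℂ)) t :=
    fun t ht => ((hψ.differentiableAt (hΩ.mem_nhds (hΩ01 t ht))).hasDerivAt).comp_ofReal
  have hF' : ∀ t ∈ Ioo (0 : ℝ) 1,
      HasDerivAt (fun t : ℝ => deriv ψ (t : ℂ)) (deriv (deriv ψ) (t : ℂ)) t :=
    fun t ht => (((hψ.deriv hΩ).differentiableAt
      (hΩ.mem_nhds (hΩ01 t ht))).hasDerivAt).comp_ofReal
  have hφ0 : ∀ r ∈ Icc (0 : ℝ) 1, φ r = 0 := by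
    refine radial_unique hrig hκ hμ hφ fun r hr => ?_
    have := radialOp_modeFactor_mul L b s κ μ hF hF' hr
    rw [heq _ (hΩ01 _ (heunCoord_mem_Ioo hr)), mul_zero] at this
    exact this
  have hψz : ∀ r ∈ Ioo (0 : ℝ) 1, ψ (heunCoord r : ℂ) = 0 := fun r hr =>
    (mul_eq_zero.1 (hφ0 r (Ioo_subset_Icc_self hr))).resolve_left
      (modeFactor_ne_zero L b μ hr.1.ne')
  have hψx : ∀ x ∈ Ioo (0 : ℝ) 1, ψ (x : ℂ) = 0 := by
    intro x hx
    have hx2 : 0 < 2 - x := by linarith [hx.2]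
    have h := hψz (√(x / (2 - x))) ⟨Real.sqrt_pos.2 (div_pos hx.1 hx2), by
      rw [Real.sqrt_lt' one_pos, div_lt_iff₀ hx2]; linarith [hx.2]⟩
    have e : heunCoord (√(x / (2 - x))) = x := by
      unfold heunCoord
      rw [Real.sq_sqrt (div_pos hx.1 hx2).le]
      field_simp
      ring
    rwa [e] at h
  have hψI : ∀ x ∈ Icc (0 : ℝ) 1, ψ (x : ℂ) = 0 :=
    eqOn_Icc_of_eqOn_Ioo hsm.continuousOn continuousOn_const hψx
  refine ⟨?_, by simpa using hψI 0 (by simp), by simpa using hψI 1 (by simp)⟩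
  have han : AnalyticOnNhd ℂ ψ Ω := hψ.analyticOnNhd hΩ
  have hhalf : (1 / 2 : ℝ) ∈ Ioo (0 : ℝ) 1 := by norm_num
  refine han.eqOn_zero_of_preconnected_of_frequently_eq_zero hΩc.isPreconnected
    (hΩ01 _ hhalf) ?_
  have htend : Filter.Tendsto (fun x : ℝ => (x : ℂ)) (nhdsWithin (1 / 2) {1 / 2}ᶜ)
      (nhdsWithin ((1 / 2 : ℝ) : ℂ) {((1 / 2 : ℝ) : ℂ)}ᶜ) := by
    refine tendsto_nhdsWithin_of_tendsto_nhds_of_eventually_within _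
      ((Complex.continuous_ofReal.tendsto _).mono_left nhdsWithin_le_nhds) ?_
    filter_upwards [self_mem_nhdsWithin] with x hx
    simpa only [mem_compl_iff, mem_singleton_iff, Complex.ofReal_inj] using hx
  refine htend.frequently (Filter.Eventually.frequently ?_)
  filter_upwards [nhdsWithin_le_nhds (isOpen_Ioo.mem_nhds hhalf)] with x hx using hψx x hx

/-- Both uniqueness statements, once the potential and the Heun coefficients of `(l, m)` are
identified with a member of the four-parameter family. -/
lemma mode_unique_of_params {l m L b : ℕ} {s κ : ℝ} (hrig : RecurrenceRigid L b s κ) (hκ : κ ≠ 0)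
    (hpot : ∀ r ∈ Ioo (0 : ℝ) 1, susyPotential l m r = rationalPotential L b s κ r)
    {μ : ℂ} (hμ : 0 ≤ μ.re)
    (hheun : ∀ z ∈ ({0, 1, 2} : Set ℂ)ᶜ, ∀ f f' f'' : ℂ, heunOp L b s κ μ z f f' f''
      = 4 * z * (z - 1) * (z - 2) * (f'' + heunP l m μ z * f' + heunQ l m μ z * f)) :
    (∀ (Ω : Set ℂ) (ψ : ℂ → ℂ), IsOpen Ω → IsConnected Ω →
      (∀ x ∈ Ioo (0 : ℝ) 1, (x : ℂ) ∈ Ω) → Ω ⊆ {0, 1, 2}ᶜ →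
      SolvesHeunModeEq l m μ Ω ψ →
      ContDiffOn ℝ ∞ (fun x : ℝ => ψ (x : ℂ)) (Icc 0 1) →
      (∀ z ∈ Ω, ψ z = 0) ∧ ψ 0 = 0 ∧ ψ 1 = 0) ∧
    (∀ φ : ℝ → ℂ, ContDiffOn ℝ ∞ φ (Icc 0 1) → SolvesRadialModeEq l m μ φ →
      ∀ r ∈ Icc (0 : ℝ) 1, φ r = 0) := by
  refine ⟨fun Ω ψ hΩ hΩc hΩ01 hreg hsol hsm => ?_, fun φ hφ hsol => ?_⟩
  · refine heun_unique hrig hκ hμ hΩ hΩc hΩ01 hsol.1 (fun z hz => ?_) hsm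
    rw [hheun z (hreg hz), hsol.2 z hz, mul_zero]
  · refine radial_unique hrig hκ hμ hφ fun r hr => ?_
    rw [← hpot r hr]
    exact hsol r hr

/-! ### Parameters of the transformed mode equations -/

/-- Both forms of the transformed mode equation with `l > 0`, `|l - m| ≤ 1` and `Re μ ≥ 0` have only
the zero solution among smooth solutions: (1) the Heun form in the variable `z`, on any domain `Ω`
of regular points containing the open segment from `0` to `1`, smoothness at the singular points
`0` and `1` being required only along that segment; (2) the radial form on `[0, 1]`. -/
theorem mainTheorem2 (l m : ℕ) (hl : 0 < l) (hm : m + 1 = l ∨ m = l ∨ m = l + 1)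
    (μ : ℂ) (hμ : 0 ≤ μ.re) :
    (∀ (Ω : Set ℂ) (ψ : ℂ → ℂ), IsOpen Ω → IsConnected Ω →
      (∀ x ∈ Ioo (0 : ℝ) 1, (x : ℂ) ∈ Ω) → Ω ⊆ {0, 1, 2}ᶜ →
      SolvesHeunModeEq l m μ Ω ψ →
      ContDiffOn ℝ ∞ (fun x : ℝ => ψ (x : ℂ)) (Icc 0 1) →
      (∀ z ∈ Ω, ψ z = 0) ∧ ψ 0 = 0 ∧ ψ 1 = 0) ∧
    (∀ φ : ℝ → ℂ, ContDiffOn ℝ ∞ φ (Icc 0 1) → SolvesRadialModeEq l m μ φ →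
      ∀ r ∈ Icc (0 : ℝ) 1, φ r = 0) := by
  have hreg : ∀ z ∈ ({0, 1, 2} : Set ℂ)ᶜ, z ≠ 0 ∧ z - 1 ≠ 0 ∧ z - 2 ≠ 0 := by
    intro z hz
    simp only [mem_compl_iff, mem_insert_iff, mem_singleton_iff, not_or] at hz
    exact ⟨hz.1, sub_ne_zero.2 hz.2.1, sub_ne_zero.2 hz.2.2⟩
  by_cases h10 : (l, m) = (1, 0)
  · obtain ⟨rfl, rfl⟩ := Prod.mk.inj h10
    refine mode_unique_of_params recurrenceRigid_one_zero (by norm_num) ?_ hμ ?_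
    · intro r hr
      have := hr.1.ne'
      simp only [susyPotential, rationalPotential]
      norm_num
      field_simp
      ring
    · intro z hz f f' f''
      obtain ⟨h0, h1, h2⟩ := hreg z hz
      simp only [heunOp, heunP, heunQ, diagCoeff, upperCoeff, lowerCoeff]
      norm_num
      field_simp
      ring
  by_cases h11 : (l, m) = (1, 1)
  · obtain ⟨rfl, rfl⟩ := Prod.mk.inj h11
    refine mode_unique_of_params recurrenceRigid_one_one (by norm_num) ?_ hμ ?_
    · intro r hr
      have := hr.1.ne'
      simp only [susyPotential, rationalPotential]
      norm_num
      field_simp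
      ring
    · intro z hz f f' f''
      obtain ⟨h0, h1, h2⟩ := hreg z hz
      simp only [heunOp, heunP, heunQ, diagCoeff, upperCoeff, lowerCoeff]
      norm_num
      field_simp
      ring
  by_cases h21 : (l, m) = (2, 1)
  · obtain ⟨rfl, rfl⟩ := Prod.mk.inj h21
    refine mode_unique_of_params recurrenceRigid_two_one (by norm_num) ?_ hμ ?_
    · intro r hr
      have := hr.1.ne'
      simp only [susyPotential, rationalPotential]
      norm_num
      field_simp
      ring
    · intro z hz f f' f''
      obtain ⟨h0, h1, h2⟩ := hreg z hz
      simp only [heunOp, heunP, heunQ, diagCoeff, upperCoeff, lowerCoeff]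
      norm_num
      field_simp
      ring
  have h01 : (l, m) ≠ (0, 1) := fun h => hl.ne' (Prod.mk.inj h).1
  simp only [Prod.mk.injEq, not_and] at h10 h11 h21
  have hm2 : 2 ≤ m := by omega
  have hm2' : (2 : ℝ) ≤ m := by exact_mod_cast hm2
  have hml : m ≤ l + 1 := by omega
  have hml' : (m : ℝ) ≤ l + 1 := by exact_mod_cast hml
  have hκ : (0 : ℝ) < m * (m + 1) - 2 := by nlinarith
  have hrig : RecurrenceRigid l l 9 (m * (m + 1) - 2) := by
    -- the excluded pairs leave only `m = 2` for `l = 1`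
    rcases Nat.lt_or_ge l 2 with hl2 | hl2
    · obtain rfl : l = 1 := by omega
      obtain rfl : m = 2 := by omega
      convert recurrenceRigid_one_two using 1
      norm_num
    · exact recurrenceRigid_generic hl2 hκ (by nlinarith)
  refine mode_unique_of_params hrig hκ.ne' ?_ hμ ?_
  · intro r hr
    have := hr.1.ne'
    simp only [susyPotential, rationalPotential, modePotential]
    rw [if_neg h01, if_neg (by simpa using h10), if_neg (by simpa using h11),
      if_neg (by simpa using h21)]
    field_simp
    ring
  · intro z hz f f' f''
    obtain ⟨h0, h1, h2⟩ := hreg z hz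
    simp only [heunOp, heunP, heunQ, diagCoeff, upperCoeff, lowerCoeff]
    rw [if_neg (by simpa using h10), if_neg (by simpa using h11), if_neg (by simpa using h21),
      if_neg (by simpa using h10), if_neg (by simpa using h11), if_neg (by simpa using h21)]
    push_cast
    field_simp
    ring
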